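/- Notation. For a complex matrix, $A^*$ is the conjugate transpose, $\|A\|$ the spectral norm, $\|A\|_F$ the Frobenius norm; $\langle U,V\rangle=\operatorname{Re}\operatorname{tr}(U^*V)$. For vectors, $\|\cdot\|$ is the Euclidean norm. There exist absolute constants $C_1,C_2\ge 1$ such that the following holds for all $d_1,d_2,n$, all $a_1,\dots,a_n\in\mathbb C^{d_1}$, $b_1,\dots,b_n\in\mathbb C^{d_2}$, and every nonzero $M_0\in\mathbb C^{d_1\times d_2}$. Let $r$ be the rank of $M_0$, let $M_0=U_0\Sigma_0V_0^*$ be a compact singular value decomposition ($U_0\in\mathbb C^{d_1\times r}$ and $V_0\in\mathbb C^{d_2\times r}$ with orthonormal columns, $\Sigma_0$ the $r\times r$ diagonal matrix of the nonzero singular values $\sigma_1(M_0)\ge\dots\ge\sigma_r(M_0)>0$), let $\kappa=\sigma_1(M_0)/\sigma_r(M_0)$, and let $$\mathcal T=\{\Delta_1V_0^*+U_0\Delta_2^*:\ \Delta_1\in\mathbb C^{d_1\times r},\ \Delta_2\in\mathbb C^{d_2\times r}\}.$$ Let $\tilde X_0\in\mathbb C^{d_1\times r}$, $\tilde Y_0\in\mathbb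 C^{d_2\times r}$ satisfy $\tilde X_0^*\tilde X_0=\tilde Y_0^*\tilde Y_0$, and suppose that for some $\rho\in(0,1]$ $$\frac1n\sum_{i=1}^n|a_i^*Hb_i|\ \ge\ \rho\|H\|_F\quad\text{for all }H\in\mathcal T,$$ $$\Big\|I_{d_1}-\frac1n\sum_{k=1}^na_ka_k^*\Big\|\le\frac{\rho}{C_1\sqrt{r\kappa}},\qquad \Big\|I_{d_2}-\frac1n\sum_{k=1}^nb_kb_k^*\Big\|\le\frac{\rho}{C_1\sqrt{r\kappa}},$$ $$\|\tilde X_0\tilde Y_0^*-M_0\|\le\frac{\rho\,\|M_0\|}{C_2\sqrt r\,\kappa^2}.$$ (The first condition holds in particular if $\frac1n\sum_i|\langle a_ib_i^*,H\rangle|\ge\rho\|H\|_F$ on $\mathcal T$, because $|\langle a_ib_i^*,H\rangle|=|\operatorname{Re}(a_i^*Hb_i)|\le|a_i^*Hb_i|$.) With $m_i=a_i^*M_0b_i$, consider the anchored regression problem of maximizing $$\langle\tilde X_0,X\rangle+\langle\tilde Y_0,Y\rangle-\frac1n\sum_{i=1}^n\Big(\tfrac12\|X^*a_i\|^2+\tfrac12\|Y^*b_i\|^2+|a_i^*XY^*b_i-m_i|\Big)$$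 over $X\in\mathbb C^{d_1\times r}$, $Y\in\mathbb C^{d_2\times r}$. Then a maximizer $(\hat X,\hat Y)$ exists, it is unique, and it satisfies $\hat X\hat Y^*=M_0$. -/

import Mathlib

open scoped Matrix

noncomputable section

namespace AnchoredRegression

/-- The Frobenius norm of a complex matrix. -/
def frobNorm {p q : ℕ} (A : Matrix (Fin p) (Fin q) ℂ) : ℝ :=
  letI := Matrix.frobeniusNormedAddCommGroup (m := Fin p) (n := Fin q) (α := ℂ)
  ‖A‖

/-- The spectral norm of a complex matrix: its operator norm between Euclidean spaces. -/
def specNorm {p q : ℕ} (A : Matrix (Fin p) (Fin q) ℂ) : ℝ :=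
  letI := Matrix.instL2OpNormedAddCommGroup (m := Fin p) (n := Fin q) (𝕜 := ℂ)
  ‖A‖

/-- The Euclidean norm of a complex vector. -/
def vecNorm {p : ℕ} (x : Fin p → ℂ) : ℝ := ‖WithLp.toLp 2 x‖

/-- The real-valued inner product `⟨U, V⟩ = Re tr (U* V)`. -/
def realInner {p q : ℕ} (U V : Matrix (Fin p) (Fin q) ℂ) : ℝ := (Uᴴ * V).trace.re

/-- The rank-one sketch `a* H b` of the matrix `H`. -/
def sketch {d₁ d₂ : ℕ} (a : Fin d₁ → ℂ) (b : Fin d₂ → ℂ) (H : Matrix (Fin d₁) (Fin d₂) ℂ) : ℂ :=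
  star a ⬝ᵥ (H *ᵥ b)

/-- The singular values of a matrix, in decreasing order and indexed from `0`. -/
def singularValue {p q : ℕ} (M : Matrix (Fin p) (Fin q) ℂ) (i : ℕ) : ℝ :=
  (Matrix.toEuclideanLin M).singularValues i

/-- The ratio of the largest and the smallest nonzero singular value of a nonzero matrix. -/
def condNumber {p q : ℕ} (M : Matrix (Fin p) (Fin q) ℂ) : ℝ :=
  singularValue M 0 / singularValue M (M.rank - 1)

/-- `M = U Σ V*` is a compact singular value decomposition of the matrix `M` of rank `r`. -/
structure IsCompactSVD {p q r : ℕ} (M : Matrix (Fin p) (Fin q) ℂ)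
    (U : Matrix (Fin p) (Fin r) ℂ) (V : Matrix (Fin q) (Fin r) ℂ) : Prop where
  rank_eq : M.rank = r
  left_orthonormal : Uᴴ * U = 1
  right_orthonormal : Vᴴ * V = 1
  eq_mul : M = U * Matrix.diagonal (fun i : Fin r => (singularValue M i : ℂ)) * Vᴴ

/-- Every matrix has a compact singular value decomposition. -/
theorem exists_isCompactSVD {p q : ℕ} (M : Matrix (Fin p) (Fin q) ℂ) :
    ∃ (U : Matrix (Fin p) (Fin M.rank) ℂ) (V : Matrix (Fin q) (Fin M.rank) ℂ),
      IsCompactSVD M U V := by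
  set T := Matrix.toEuclideanLin M with hT
  have hn : Module.finrank ℂ (EuclideanSpace ℂ (Fin q)) = q := by simp
  have hr : Module.finrank ℂ (LinearMap.range T) = M.rank :=
    (Matrix.rank_eq_finrank_range_toLin M (PiLp.basisFun 2 ℂ (Fin p))
      (PiLp.basisFun 2 ℂ (Fin q))).symm ▸ by
      rw [hT, Matrix.toEuclideanLin, Matrix.toLpLin_eq_toLin]
  have hrq : M.rank ≤ q := by simpa using M.rank_le_width
  set v := T.isSymmetric_adjoint_comp_self.eigenvectorBasis hn with hv
  set s : ℕ → ℝ := fun i => T.singularValues i with hs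
  have hpos : ∀ i : Fin M.rank, 0 < s i := fun i =>
    T.singularValues_pos_iff_lt_finrank_range.2 (by rw [hr]; exact i.2)
  have hinner : ∀ i j : Fin q, inner ℂ (T (v i)) (T (v j)) = if i = j then (s j : ℂ) ^ 2 else 0 := by
    intro i j
    rw [← LinearMap.adjoint_inner_right]
    have h1 : (LinearMap.adjoint T) (T (v j)) = ((s j : ℂ) ^ 2) • v j := by
      have := T.isSymmetric_adjoint_comp_self.apply_eigenvectorBasis hn j
      rw [← T.sq_singularValues_fin hn j] at this
      exact this.trans (by push_cast; rfl)
    rw [h1, inner_smul_right, orthonormal_iff_ite.1 v.orthonormal i j]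
    simp
  let e : Fin M.rank → Fin q := Fin.castLE hrq
  have he : Function.Injective e := Fin.castLE_injective hrq
  refine ⟨Matrix.of fun k i => ((s i : ℂ)⁻¹ • T (v (e i))) k, Matrix.of fun k i => v (e i) k,
    rfl, ?_, ?_, ?_⟩
  · ext i j
    have h := hinner (e i) (e j)
    have hi : (s i : ℂ) ≠ 0 := by exact_mod_cast (hpos i).ne'
    have hj : (s j : ℂ) ≠ 0 := by exact_mod_cast (hpos j).ne'
    have h2 : inner ℂ ((s i : ℂ)⁻¹ • T (v (e i))) ((s j : ℂ)⁻¹ • T (v (e j)))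
        = if i = j then 1 else 0 := by
      rw [inner_smul_left, inner_smul_right, h]
      by_cases hij : i = j
      · subst hij
        simp [e]
        field_simp
      · simp [hij, he.ne hij]
    rw [Matrix.one_apply, ← h2, PiLp.inner_apply]
    simp [Matrix.mul_apply, mul_comm]
  · ext i j
    have h2 := orthonormal_iff_ite.1 v.orthonormal (e i) (e j)
    rw [PiLp.inner_apply] at h2
    simp only [he.eq_iff] at h2
    rw [Matrix.one_apply, ← h2]
    simp [Matrix.mul_apply, mul_comm]
  · have hzero : ∀ j : Fin q, j ∉ Set.range e → T (v j) = 0 := by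
      intro j hj
      have hle : M.rank ≤ j := by
        by_contra hlt
        exact hj ⟨⟨j, by omega⟩, rfl⟩
      have hsj : s j = 0 := T.singularValues_eq_zero_iff_le_finrank_range.2 (by rw [hr]; exact hle)
      have := hinner j j
      rw [if_pos rfl, hsj] at this
      simpa using this
    ext k l
    have h1 : M k l = T (EuclideanSpace.single l 1) k := by
      simp [hT, Matrix.toLpLin_apply]
    have h2 : T (EuclideanSpace.single l 1) = ∑ j, star (v j l) • T (v j) := by
      conv_lhs => rw [← v.sum_repr (EuclideanSpace.single l 1)]
      rw [map_sum]
      refine Finset.sum_congr rfl fun j _ => ?_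
      rw [map_smul, v.repr_apply_apply, EuclideanSpace.inner_single_right]
      simp
    have h3 : ∑ j, star (v j l) • T (v j) = ∑ i, star (v (e i) l) • T (v (e i)) :=
      (Fintype.sum_of_injective e he _ _ (fun j hj => by rw [hzero j hj, smul_zero])
        fun _ => rfl).symm
    rw [h1, h2, h3]
    rw [Matrix.mul_apply]
    simp only [Matrix.mul_diagonal, Matrix.of_apply, Matrix.conjTranspose_apply,
      WithLp.ofLp_sum, Finset.sum_apply, PiLp.smul_apply, smul_eq_mul]
    refine Finset.sum_congr rfl fun i _ => ?_
    have hi : (s i : ℂ) ≠ 0 := by exact_mod_cast (hpos i).ne'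
    change _ = (s i : ℂ)⁻¹ * _ * (s i : ℂ) * _
    field_simp

/-- The support space `{Δ₁ V* + U Δ₂*}`. -/
def supportSpace {p q r : ℕ} (U : Matrix (Fin p) (Fin r) ℂ) (V : Matrix (Fin q) (Fin r) ℂ) :
    Set (Matrix (Fin p) (Fin q) ℂ) :=
  {H | ∃ (D₁ : Matrix (Fin p) (Fin r) ℂ) (D₂ : Matrix (Fin q) (Fin r) ℂ), H = D₁ * Vᴴ + U * D₂ᴴ}

/-- The sample second-moment matrix `(1/n) ∑ₖ aₖ aₖ*`. -/
def sampleCov {d n : ℕ} (a : Fin n → Fin d → ℂ) : Matrix (Fin d) (Fin d) ℂ :=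
  (1 / (n : ℂ)) • ∑ k, Matrix.vecMulVec (a k) (star (a k))

/-- The loss `½ ‖X* a‖² + ½ ‖Y* b‖² + |a* X Y* b - m|` of one measurement `m`. -/
def loss {d₁ d₂ r : ℕ} (a : Fin d₁ → ℂ) (b : Fin d₂ → ℂ) (m : ℂ)
    (X : Matrix (Fin d₁) (Fin r) ℂ) (Y : Matrix (Fin d₂) (Fin r) ℂ) : ℝ :=
  1 / 2 * vecNorm (Xᴴ *ᵥ a) ^ 2 + 1 / 2 * vecNorm (Yᴴ *ᵥ b) ^ 2 + ‖sketch a b (X * Yᴴ) - m‖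

/-- The objective function of anchored regression with anchors `Xt`, `Yt` and data `a`, `b`, `m`. -/
def objective {d₁ d₂ r n : ℕ} (a : Fin n → Fin d₁ → ℂ) (b : Fin n → Fin d₂ → ℂ) (m : Fin n → ℂ)
    (Xt : Matrix (Fin d₁) (Fin r) ℂ) (Yt : Matrix (Fin d₂) (Fin r) ℂ)
    (P : Matrix (Fin d₁) (Fin r) ℂ × Matrix (Fin d₂) (Fin r) ℂ) : ℝ :=
  realInner Xt P.1 + realInner Yt P.2 - 1 / (n : ℝ) * ∑ i, loss (a i) (b i) (m i) P.1 P.2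

/-- `P = (X, Y)` solves the anchored regression problem: it maximizes the objective function over
all pairs of factors. -/
def IsEstimate {d₁ d₂ r n : ℕ} (a : Fin n → Fin d₁ → ℂ) (b : Fin n → Fin d₂ → ℂ) (m : Fin n → ℂ)
    (Xt : Matrix (Fin d₁) (Fin r) ℂ) (Yt : Matrix (Fin d₂) (Fin r) ℂ)
    (P : Matrix (Fin d₁) (Fin r) ℂ × Matrix (Fin d₂) (Fin r) ℂ) : Prop :=
  IsMaxOn (objective a b m Xt Yt) Set.univ P

end AnchoredRegression

end

noncomputable section

namespace AnchoredRegression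

section

variable {p q r : ℕ}

/-! ### Euclidean norm of vectors -/

/-! The objective is a concave quadratic `smoothPart` minus the mean absolute sketch of `X Y* - M₀`.
Move by `(D₁, D₂)` from a factorization `X₀ Y₀* = M₀`: the residual is `H + D₁ D₂*` with `H = X₀ D₂*
+ D₁ Y₀*`. By Cauchy–Schwarz and AM–GM, the sketches of `D₁ D₂*` are paid for exactly by the
quadratic terms (`meanAbsSketch_add_mul_ge`). What remains is the gradient of the smooth part paired
with `(D₁, D₂)`, minus the mean absolute sketch of `H`, which is at least `ρ‖H‖_F` because `H` lies
in the support space. So it suffices that the pairing is at most `c‖H‖_F` for some `c < ρ`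
(`objective_lt_of_certificate`).

Such a bound forces the pairing to vanish on the directions `(X₀ K, -Y₀ K*)`, where `H = 0`; they
are tangent to the fibre `X Y* = M₀`. Hence `(X₀, Y₀)` is chosen to maximize the smooth part on that
fibre, and stationarity gives the vanishing (`gradient_eq_of_isMaxOn_smoothPart`). Modulo these
directions the pairing is controlled by the least singular value of the factors
(`realInner_add_realInner_le`). The gradient is small because balanced anchors lie near some
factorization of `M₀` (`exists_factorization_near`), the second moments are near the identity, and
strong concavity keeps the maximizer nearby (`exists_isMaxOn_smoothPart`). `exists_certificate`
assembles these estimates. -/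

theorem vecNorm_nonneg (x : Fin p → ℂ) : 0 ≤ vecNorm x := norm_nonneg _

theorem vecNorm_eq_zero {x : Fin p → ℂ} : vecNorm x = 0 ↔ x = 0 := by
  simp [vecNorm]

theorem vecNorm_sub_le_vecNorm_sub (x y : Fin p → ℂ) :
    vecNorm x - vecNorm y ≤ vecNorm (x - y) := by
  simpa [vecNorm] using norm_sub_norm_le (WithLp.toLp 2 x) (WithLp.toLp 2 y)

theorem dotProduct_star_self (x : Fin p → ℂ) : star x ⬝ᵥ x = (vecNorm x : ℂ) ^ 2 := by
  have h := inner_self_eq_norm_sq_to_K (𝕜 := ℂ) (WithLp.toLp 2 x)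
  rw [EuclideanSpace.inner_eq_star_dotProduct] at h
  simpa [vecNorm, dotProduct_comm] using h

theorem norm_star_dotProduct_le (x y : Fin p → ℂ) :
    ‖star x ⬝ᵥ y‖ ≤ vecNorm x * vecNorm y := by
  have h := norm_inner_le_norm (𝕜 := ℂ) (WithLp.toLp 2 x) (WithLp.toLp 2 y)
  rw [EuclideanSpace.inner_eq_star_dotProduct] at h
  simpa [vecNorm, dotProduct_comm] using h

theorem star_mulVec_dotProduct (A : Matrix (Fin p) (Fin q) ℂ) (x : Fin q → ℂ) (y : Fin p → ℂ) :
    star (A *ᵥ x) ⬝ᵥ y = star x ⬝ᵥ (Aᴴ *ᵥ y) := by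
  rw [Matrix.star_mulVec, Matrix.dotProduct_mulVec]

theorem vecNorm_mulVec_eq_of_gram_eq {d : ℕ} {A : Matrix (Fin p) (Fin q) ℂ}
    {B : Matrix (Fin d) (Fin q) ℂ} (h : Aᴴ * A = Bᴴ * B) (x : Fin q → ℂ) :
    vecNorm (A *ᵥ x) = vecNorm (B *ᵥ x) := by
  have h1 : ((vecNorm (A *ᵥ x) : ℂ)) ^ 2 = (vecNorm (B *ᵥ x) : ℂ) ^ 2 := by
    rw [← dotProduct_star_self, ← dotProduct_star_self, star_mulVec_dotProduct,
      star_mulVec_dotProduct, Matrix.mulVec_mulVec, Matrix.mulVec_mulVec, h]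
  have h2 : vecNorm (A *ᵥ x) ^ 2 = vecNorm (B *ᵥ x) ^ 2 := by exact_mod_cast h1
  exact (pow_left_inj₀ (vecNorm_nonneg _) (vecNorm_nonneg _) two_ne_zero).1 h2

theorem vecNorm_mulVec_of_orthonormal {U : Matrix (Fin p) (Fin q) ℂ} (hU : Uᴴ * U = 1)
    (x : Fin q → ℂ) : vecNorm (U *ᵥ x) = vecNorm x := by
  have := vecNorm_mulVec_eq_of_gram_eq (A := U) (B := (1 : Matrix (Fin q) (Fin q) ℂ))
    (by simpa using hU) x
  simpa using this

/-! ### Spectral norm -/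

theorem specNorm_nonneg (A : Matrix (Fin p) (Fin q) ℂ) : 0 ≤ specNorm A := by
  let _ := Matrix.instL2OpNormedAddCommGroup (m := Fin p) (n := Fin q) (𝕜 := ℂ)
  exact norm_nonneg A

theorem vecNorm_mulVec_le (A : Matrix (Fin p) (Fin q) ℂ) (x : Fin q → ℂ) :
    vecNorm (A *ᵥ x) ≤ specNorm A * vecNorm x :=
  Matrix.l2_opNorm_mulVec A (WithLp.toLp 2 x)

theorem specNorm_le {A : Matrix (Fin p) (Fin q) ℂ} {c : ℝ} (hc : 0 ≤ c)
    (h : ∀ x, vecNorm (A *ᵥ x) ≤ c * vecNorm x) : specNorm A ≤ c := by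
  let _ := Matrix.instL2OpNormedAddCommGroup (m := Fin p) (n := Fin q) (𝕜 := ℂ)
  change ‖A‖ ≤ c
  rw [Matrix.l2_opNorm_def]
  exact ContinuousLinearMap.opNorm_le_bound _ hc fun x => h x.ofLp

theorem specNorm_conjTranspose (A : Matrix (Fin p) (Fin q) ℂ) : specNorm Aᴴ = specNorm A :=
  Matrix.l2_opNorm_conjTranspose A

theorem specNorm_conjTranspose_mul_self (A : Matrix (Fin p) (Fin q) ℂ) :
    specNorm (Aᴴ * A) = specNorm A * specNorm A :=
  Matrix.l2_opNorm_conjTranspose_mul_self A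

theorem specNorm_mul_le {d : ℕ} (A : Matrix (Fin p) (Fin q) ℂ) (B : Matrix (Fin q) (Fin d) ℂ) :
    specNorm (A * B) ≤ specNorm A * specNorm B :=
  Matrix.l2_opNorm_mul A B

theorem specNorm_add_le (A B : Matrix (Fin p) (Fin q) ℂ) :
    specNorm (A + B) ≤ specNorm A + specNorm B := by
  let _ := Matrix.instL2OpNormedAddCommGroup (m := Fin p) (n := Fin q) (𝕜 := ℂ)
  exact norm_add_le A B

theorem specNorm_neg (A : Matrix (Fin p) (Fin q) ℂ) : specNorm (-A) = specNorm A := by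
  let _ := Matrix.instL2OpNormedAddCommGroup (m := Fin p) (n := Fin q) (𝕜 := ℂ)
  exact norm_neg A

theorem specNorm_le_one_of_orthonormal {U : Matrix (Fin p) (Fin q) ℂ} (hU : Uᴴ * U = 1) :
    specNorm U ≤ 1 :=
  specNorm_le zero_le_one fun x => by rw [vecNorm_mulVec_of_orthonormal hU, one_mul]

/-- A matrix that is bounded below on vectors controls its right factor. -/
theorem specNorm_le_div_of_mul {d : ℕ} {A : Matrix (Fin p) (Fin q) ℂ} {s : ℝ} (hs : 0 < s)
    (hA : ∀ z, s * vecNorm z ≤ vecNorm (A *ᵥ z)) (B : Matrix (Fin q) (Fin d) ℂ) :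
    specNorm B ≤ specNorm (A * B) / s := by
  refine specNorm_le (div_nonneg (specNorm_nonneg _) hs.le) fun x => ?_
  rw [div_mul_eq_mul_div, le_div_iff₀ hs, mul_comm]
  refine (hA _).trans ?_
  rw [Matrix.mulVec_mulVec]
  exact vecNorm_mulVec_le _ _

/-! ### Frobenius norm and trace inner product -/

/-- A matrix as a Euclidean vector of its entries. -/
def flatten (A : Matrix (Fin p) (Fin q) ℂ) : EuclideanSpace ℂ (Fin p × Fin q) :=
  WithLp.toLp 2 fun ij => A ij.1 ij.2

theorem flatten_add (A B : Matrix (Fin p) (Fin q) ℂ) :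
    flatten (A + B) = flatten A + flatten B := rfl

theorem norm_flatten (A : Matrix (Fin p) (Fin q) ℂ) : ‖flatten A‖ = frobNorm A := by
  let _ := Matrix.frobeniusNormedAddCommGroup (m := Fin p) (n := Fin q) (α := ℂ)
  change _ = ‖A‖
  rw [Matrix.frobenius_norm_def, EuclideanSpace.norm_eq, Real.sqrt_eq_rpow,
    Fintype.sum_prod_type]
  simp [flatten]

theorem re_inner_flatten (A B : Matrix (Fin p) (Fin q) ℂ) :
    (inner ℂ (flatten A) (flatten B)).re = realInner A B := by
  rw [PiLp.inner_apply, Fintype.sum_prod_type_right]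
  simp [flatten, realInner, Matrix.trace, Matrix.mul_apply, mul_comm]

theorem realInner_eq_sum (A B : Matrix (Fin p) (Fin q) ℂ) :
    realInner A B = ∑ i, ∑ j, (star (A i j) * B i j).re := by
  rw [Finset.sum_comm]
  simp [realInner, Matrix.trace, Matrix.mul_apply]

theorem frobNorm_nonneg (A : Matrix (Fin p) (Fin q) ℂ) : 0 ≤ frobNorm A := by
  rw [← norm_flatten]; exact norm_nonneg _

theorem frobNorm_eq_zero {A : Matrix (Fin p) (Fin q) ℂ} : frobNorm A = 0 ↔ A = 0 := by
  let _ := Matrix.frobeniusNormedAddCommGroup (m := Fin p) (n := Fin q) (α := ℂ)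
  exact norm_eq_zero (a := A)

theorem frobNorm_add_le (A B : Matrix (Fin p) (Fin q) ℂ) :
    frobNorm (A + B) ≤ frobNorm A + frobNorm B := by
  rw [← norm_flatten, ← norm_flatten, ← norm_flatten, flatten_add]; exact norm_add_le _ _

theorem frobNorm_neg (A : Matrix (Fin p) (Fin q) ℂ) : frobNorm (-A) = frobNorm A := by
  let _ := Matrix.frobeniusNormedAddCommGroup (m := Fin p) (n := Fin q) (α := ℂ)
  exact norm_neg A

theorem frobNorm_conjTranspose (A : Matrix (Fin p) (Fin q) ℂ) : frobNorm Aᴴ = frobNorm A :=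
  Matrix.frobenius_norm_conjTranspose A

theorem realInner_self (A : Matrix (Fin p) (Fin q) ℂ) : realInner A A = frobNorm A ^ 2 := by
  rw [← re_inner_flatten, ← norm_flatten]
  exact inner_self_eq_norm_sq (𝕜 := ℂ) (flatten A)

theorem realInner_le (A B : Matrix (Fin p) (Fin q) ℂ) :
    realInner A B ≤ frobNorm A * frobNorm B := by
  rw [← re_inner_flatten, ← norm_flatten, ← norm_flatten]
  exact re_inner_le_norm (𝕜 := ℂ) _ _

theorem realInner_comm (A B : Matrix (Fin p) (Fin q) ℂ) : realInner A B = realInner B A := by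
  simp only [realInner_eq_sum]
  refine Finset.sum_congr rfl fun i _ => Finset.sum_congr rfl fun j _ => ?_
  simp; ring

theorem realInner_add_left (A B C : Matrix (Fin p) (Fin q) ℂ) :
    realInner (A + B) C = realInner A C + realInner B C := by
  simp [realInner, Matrix.add_mul]

theorem realInner_add_right (A B C : Matrix (Fin p) (Fin q) ℂ) :
    realInner A (B + C) = realInner A B + realInner A C := by
  simp [realInner, Matrix.mul_add]

theorem realInner_sub_left (A B C : Matrix (Fin p) (Fin q) ℂ) :
    realInner (A - B) C = realInner A C - realInner B C := by
  simp [realInner, Matrix.sub_mul]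

theorem realInner_sub_right (A B C : Matrix (Fin p) (Fin q) ℂ) :
    realInner A (B - C) = realInner A B - realInner A C := by
  simp [realInner, Matrix.mul_sub]

theorem realInner_mul_left {d : ℕ} (A : Matrix (Fin p) (Fin d) ℂ) (B : Matrix (Fin d) (Fin q) ℂ)
    (C : Matrix (Fin p) (Fin q) ℂ) : realInner (A * B) C = realInner B (Aᴴ * C) := by
  simp [realInner, Matrix.mul_assoc]

theorem frobNorm_sq_eq_sum (A : Matrix (Fin p) (Fin q) ℂ) :
    frobNorm A ^ 2 = ∑ j, vecNorm (A *ᵥ Pi.single j 1) ^ 2 := by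
  rw [← norm_flatten, EuclideanSpace.norm_sq_eq, Fintype.sum_prod_type_right]
  refine Finset.sum_congr rfl fun j _ => ?_
  rw [vecNorm, EuclideanSpace.norm_sq_eq]
  simp [flatten]

theorem vecNorm_single (j : Fin q) : vecNorm (Pi.single j (1 : ℂ)) = 1 := by
  simp [vecNorm]

theorem frobNorm_mul_le {d : ℕ} (A : Matrix (Fin p) (Fin q) ℂ) (B : Matrix (Fin q) (Fin d) ℂ) :
    frobNorm (A * B) ≤ specNorm A * frobNorm B := by
  refine le_of_sq_le_sq ?_ (mul_nonneg (specNorm_nonneg _) (frobNorm_nonneg _))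
  rw [mul_pow, frobNorm_sq_eq_sum, frobNorm_sq_eq_sum, Finset.mul_sum]
  refine Finset.sum_le_sum fun j _ => ?_
  rw [← Matrix.mulVec_mulVec, ← mul_pow]
  exact pow_le_pow_left₀ (vecNorm_nonneg _) (vecNorm_mulVec_le _ _) 2

theorem mul_frobNorm_le_frobNorm_mul {d : ℕ} {A : Matrix (Fin p) (Fin q) ℂ} {s : ℝ} (hs : 0 ≤ s)
    (hA : ∀ z, s * vecNorm z ≤ vecNorm (A *ᵥ z)) (B : Matrix (Fin q) (Fin d) ℂ) :
    s * frobNorm B ≤ frobNorm (A * B) := by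
  refine le_of_sq_le_sq ?_ (frobNorm_nonneg _)
  rw [mul_pow, frobNorm_sq_eq_sum, frobNorm_sq_eq_sum, Finset.mul_sum]
  refine Finset.sum_le_sum fun j _ => ?_
  rw [← Matrix.mulVec_mulVec, ← mul_pow]
  exact pow_le_pow_left₀ (mul_nonneg hs (vecNorm_nonneg _)) (hA _) 2

theorem frobNorm_le_sqrt_mul_specNorm (A : Matrix (Fin p) (Fin q) ℂ) :
    frobNorm A ≤ √(q : ℝ) * specNorm A := by
  refine le_of_sq_le_sq ?_ (mul_nonneg (Real.sqrt_nonneg _) (specNorm_nonneg _))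
  rw [mul_pow, Real.sq_sqrt (Nat.cast_nonneg q), frobNorm_sq_eq_sum]
  calc ∑ j : Fin q, vecNorm (A *ᵥ Pi.single j 1) ^ 2 ≤ ∑ _j : Fin q, specNorm A ^ 2 := by
        refine Finset.sum_le_sum fun j _ => pow_le_pow_left₀ (vecNorm_nonneg _) ?_ 2
        simpa [vecNorm_single] using vecNorm_mulVec_le A (Pi.single j 1)
    _ = _ := by simp

theorem specNorm_le_frobNorm (A : Matrix (Fin p) (Fin q) ℂ) : specNorm A ≤ frobNorm A := by
  refine specNorm_le (frobNorm_nonneg _) fun x => ?_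
  have hcol : ∀ {k : ℕ} (v : Fin k → ℂ), frobNorm (Matrix.replicateCol (Fin 1) v) = vecNorm v :=
    fun v => Matrix.frobenius_norm_replicateCol v
  have h2 : A * Matrix.replicateCol (Fin 1) x = Matrix.replicateCol (Fin 1) (A *ᵥ x) := rfl
  rw [← hcol, ← hcol, ← h2]
  exact Matrix.frobenius_norm_mul A (Matrix.replicateCol (Fin 1) x)

theorem isUnit_of_bounded_below {A : Matrix (Fin q) (Fin q) ℂ} {s : ℝ} (hs : 0 < s)
    (hA : ∀ z, s * vecNorm z ≤ vecNorm (A *ᵥ z)) : IsUnit A := by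
  rw [← Matrix.mulVec_injective_iff_isUnit]
  intro x y hxy
  have h := hA (x - y)
  rw [Matrix.mulVec_sub, sub_eq_zero.2 hxy, vecNorm_eq_zero.2 rfl] at h
  have h2 : vecNorm (x - y) = 0 :=
    le_antisymm (nonpos_of_mul_nonpos_right h hs) (vecNorm_nonneg _)
  exact sub_eq_zero.1 (vecNorm_eq_zero.1 h2)

theorem isUnit_gram_of_bounded_below {A : Matrix (Fin p) (Fin q) ℂ} {s : ℝ} (hs : 0 < s)
    (hA : ∀ z, s * vecNorm z ≤ vecNorm (A *ᵥ z)) : IsUnit (Aᴴ * A) := by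
  rw [← Matrix.mulVec_injective_iff_isUnit]
  intro x y hxy
  have h0 : (Aᴴ * A) *ᵥ (x - y) = 0 := by rw [Matrix.mulVec_sub, sub_eq_zero.2 hxy]
  have h1 : (vecNorm (A *ᵥ (x - y)) : ℂ) ^ 2 = 0 := by
    rw [← dotProduct_star_self, star_mulVec_dotProduct, Matrix.mulVec_mulVec, h0,
      dotProduct_zero]
  have h2 : vecNorm (A *ᵥ (x - y)) = 0 := by exact_mod_cast pow_eq_zero_iff two_ne_zero |>.1 h1
  have h := hA (x - y)
  rw [h2] at h
  have h3 : vecNorm (x - y) = 0 :=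
    le_antisymm (nonpos_of_mul_nonpos_right h hs) (vecNorm_nonneg _)
  exact sub_eq_zero.1 (vecNorm_eq_zero.1 h3)

end

section

variable {d d₁ d₂ r n : ℕ}

/-! ### The objective function -/

theorem isHermitian_sampleCov (a : Fin n → Fin d → ℂ) : (sampleCov a)ᴴ = sampleCov a := by
  simp [sampleCov, Matrix.conjTranspose_sum, Matrix.conjTranspose_vecMulVec]

theorem realInner_vecMulVec_mul (v : Fin d → ℂ) (X : Matrix (Fin d) (Fin r) ℂ) :
    realInner X (Matrix.vecMulVec v (star v) * X) = vecNorm (Xᴴ *ᵥ v) ^ 2 := by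
  have h : star v ᵥ* X = star (Xᴴ *ᵥ v) := by
    rw [Matrix.star_mulVec, Matrix.conjTranspose_conjTranspose]
  rw [realInner, Matrix.vecMulVec_mul, Matrix.mul_vecMulVec, Matrix.trace_vecMulVec, h,
    dotProduct_comm, dotProduct_star_self]
  norm_cast

theorem realInner_sampleCov_mul (a : Fin n → Fin d → ℂ) (X : Matrix (Fin d) (Fin r) ℂ) :
    realInner X (sampleCov a * X) = 1 / (n : ℝ) * ∑ i, vecNorm (Xᴴ *ᵥ a i) ^ 2 := by
  simp only [← realInner_vecMulVec_mul, realInner, sampleCov, Matrix.smul_mul, Matrix.sum_mul,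
    Matrix.mul_smul, Matrix.mul_sum, Matrix.trace_smul, Matrix.trace_sum, ← Complex.re_sum]
  have : (1 / (n : ℂ)) = ((1 / (n : ℝ) : ℝ) : ℂ) := by push_cast; rfl
  rw [this, smul_eq_mul, Complex.re_ofReal_mul]

theorem sketch_sub (a : Fin d₁ → ℂ) (b : Fin d₂ → ℂ) (H K : Matrix (Fin d₁) (Fin d₂) ℂ) :
    sketch a b (H - K) = sketch a b H - sketch a b K := by
  simp [sketch, Matrix.sub_mulVec, dotProduct_sub]

theorem norm_sketch_mul_le (a : Fin d₁ → ℂ) (b : Fin d₂ → ℂ) (X : Matrix (Fin d₁) (Fin r) ℂ)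
    (Y : Matrix (Fin d₂) (Fin r) ℂ) :
    ‖sketch a b (X * Yᴴ)‖ ≤ vecNorm (Xᴴ *ᵥ a) * vecNorm (Yᴴ *ᵥ b) := by
  have h : sketch a b (X * Yᴴ) = star (Xᴴ *ᵥ a) ⬝ᵥ (Yᴴ *ᵥ b) := by
    rw [sketch, star_mulVec_dotProduct, Matrix.conjTranspose_conjTranspose,
      Matrix.mulVec_mulVec]
  rw [h]
  exact norm_star_dotProduct_le _ _

/-- The average absolute value of the sketches of a matrix. -/
def meanAbsSketch (a : Fin n → Fin d₁ → ℂ) (b : Fin n → Fin d₂ → ℂ)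
    (H : Matrix (Fin d₁) (Fin d₂) ℂ) : ℝ :=
  1 / (n : ℝ) * ∑ i, ‖sketch (a i) (b i) H‖

theorem meanAbsSketch_nonneg (a : Fin n → Fin d₁ → ℂ) (b : Fin n → Fin d₂ → ℂ)
    (H : Matrix (Fin d₁) (Fin d₂) ℂ) : 0 ≤ meanAbsSketch a b H := by
  unfold meanAbsSketch; positivity

/-- Each sketch of `X Y*` is the inner product of `X* a` and `Y* b`, hence at most half the sum of
their squared norms. The coefficients match the quadratic terms of the loss, so nothing second-order
survives. -/
theorem meanAbsSketch_add_mul_ge (a : Fin n → Fin d₁ → ℂ) (b : Fin n → Fin d₂ → ℂ)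
    (H : Matrix (Fin d₁) (Fin d₂) ℂ) (X : Matrix (Fin d₁) (Fin r) ℂ)
    (Y : Matrix (Fin d₂) (Fin r) ℂ) :
    meanAbsSketch a b H - 1 / 2 * realInner X (sampleCov a * X)
      - 1 / 2 * realInner Y (sampleCov b * Y) ≤ meanAbsSketch a b (H + X * Yᴴ) := by
  have h : ∀ i, ‖sketch (a i) (b i) H‖ ≤ ‖sketch (a i) (b i) (H + X * Yᴴ)‖
      + 1 / 2 * vecNorm (Xᴴ *ᵥ a i) ^ 2 + 1 / 2 * vecNorm (Yᴴ *ᵥ b i) ^ 2 := by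
    intro i
    have h1 := norm_sub_le (sketch (a i) (b i) (H + X * Yᴴ)) (sketch (a i) (b i) (X * Yᴴ))
    rw [← sketch_sub, add_sub_cancel_right] at h1
    have h2 := norm_sketch_mul_le (a i) (b i) X Y
    nlinarith [sq_nonneg (vecNorm (Xᴴ *ᵥ a i) - vecNorm (Yᴴ *ᵥ b i))]
  have hs := mul_le_mul_of_nonneg_left (Finset.sum_le_sum fun i (_ : i ∈ Finset.univ) => h i)
    (by positivity : 0 ≤ 1 / (n : ℝ))
  rw [Finset.sum_add_distrib, Finset.sum_add_distrib, ← Finset.mul_sum, ← Finset.mul_sum] at hs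
  rw [realInner_sampleCov_mul, realInner_sampleCov_mul]
  simp only [meanAbsSketch]
  linarith

/-- The smooth part of the objective function, with second-moment matrices `A` and `B`. -/
def smoothPart (A : Matrix (Fin d₁) (Fin d₁) ℂ) (B : Matrix (Fin d₂) (Fin d₂) ℂ)
    (Xt : Matrix (Fin d₁) (Fin r) ℂ) (Yt : Matrix (Fin d₂) (Fin r) ℂ)
    (X : Matrix (Fin d₁) (Fin r) ℂ) (Y : Matrix (Fin d₂) (Fin r) ℂ) : ℝ :=
  realInner Xt X + realInner Yt Y - 1 / 2 * realInner X (A * X) - 1 / 2 * realInner Y (B * Y)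

theorem objective_eq (a : Fin n → Fin d₁ → ℂ) (b : Fin n → Fin d₂ → ℂ)
    (M : Matrix (Fin d₁) (Fin d₂) ℂ) (Xt : Matrix (Fin d₁) (Fin r) ℂ)
    (Yt : Matrix (Fin d₂) (Fin r) ℂ) (X : Matrix (Fin d₁) (Fin r) ℂ)
    (Y : Matrix (Fin d₂) (Fin r) ℂ) :
    objective a b (fun i => sketch (a i) (b i) M) Xt Yt (X, Y) =
      smoothPart (sampleCov a) (sampleCov b) Xt Yt X Y - meanAbsSketch a b (X * Yᴴ - M) := by
  simp only [objective, loss, smoothPart, meanAbsSketch, realInner_sampleCov_mul,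
    Finset.sum_add_distrib, ← Finset.mul_sum, sketch_sub]
  ring

theorem realInner_mul_self_add {A : Matrix (Fin d) (Fin d) ℂ} (hA : Aᴴ = A)
    (X D : Matrix (Fin d) (Fin r) ℂ) :
    realInner (X + D) (A * (X + D)) =
      realInner X (A * X) + 2 * realInner (A * X) D + realInner D (A * D) := by
  have h1 : realInner X (A * D) = realInner (A * X) D := by rw [realInner_mul_left, hA]
  rw [Matrix.mul_add, realInner_add_left, realInner_add_right, realInner_add_right, h1,
    realInner_comm D (A * X)]
  ring

theorem smoothPart_add {A : Matrix (Fin d₁) (Fin d₁) ℂ} {B : Matrix (Fin d₂) (Fin d₂) ℂ}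
    (hA : Aᴴ = A) (hB : Bᴴ = B) (Xt : Matrix (Fin d₁) (Fin r) ℂ) (Yt : Matrix (Fin d₂) (Fin r) ℂ)
    (X D₁ : Matrix (Fin d₁) (Fin r) ℂ) (Y D₂ : Matrix (Fin d₂) (Fin r) ℂ) :
    smoothPart A B Xt Yt (X + D₁) (Y + D₂) = smoothPart A B Xt Yt X Y
      + (realInner (Xt - A * X) D₁ + realInner (Yt - B * Y) D₂)
      - 1 / 2 * realInner D₁ (A * D₁) - 1 / 2 * realInner D₂ (B * D₂) := by
  simp only [smoothPart, realInner_mul_self_add hA, realInner_mul_self_add hB,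
    realInner_add_right, realInner_sub_left]
  ring

theorem half_frobNorm_sq_le {A : Matrix (Fin d) (Fin d) ℂ} (hA : specNorm (1 - A) ≤ 1 / 2)
    (X : Matrix (Fin d) (Fin r) ℂ) : 1 / 2 * frobNorm X ^ 2 ≤ realInner X (A * X) := by
  have h1 : A * X = X - (1 - A) * X := by rw [Matrix.sub_mul]; simp
  have h2 := realInner_le X ((1 - A) * X)
  have h3 := frobNorm_mul_le (1 - A) X
  have h4 := frobNorm_nonneg X
  rw [h1, realInner_sub_right, realInner_self]
  nlinarith [mul_le_mul_of_nonneg_left h3 h4, mul_le_mul_of_nonneg_right hA (sq_nonneg (frobNorm X))]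

/-! ### Optimality certificate -/

/-- A factorization of the ground truth at which the gradient of the smooth part is dominated by
the sketches is the strict global maximizer of the objective function. -/
theorem objective_lt_of_certificate {a : Fin n → Fin d₁ → ℂ} {b : Fin n → Fin d₂ → ℂ}
    {Xt X₀ : Matrix (Fin d₁) (Fin r) ℂ} {Yt Y₀ : Matrix (Fin d₂) (Fin r) ℂ} {ρ c : ℝ}
    (ha : specNorm (1 - sampleCov a) ≤ 1 / 2) (hb : specNorm (1 - sampleCov b) ≤ 1 / 2)
    (hc : c < ρ)
    (hsk : ∀ (D₁ : Matrix (Fin d₁) (Fin r) ℂ) (D₂ : Matrix (Fin d₂) (Fin r) ℂ),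
      ρ * frobNorm (X₀ * D₂ᴴ + D₁ * Y₀ᴴ) ≤ meanAbsSketch a b (X₀ * D₂ᴴ + D₁ * Y₀ᴴ))
    (hgrad : ∀ (D₁ : Matrix (Fin d₁) (Fin r) ℂ) (D₂ : Matrix (Fin d₂) (Fin r) ℂ),
      realInner (Xt - sampleCov a * X₀) D₁ + realInner (Yt - sampleCov b * Y₀) D₂ ≤
        c * frobNorm (X₀ * D₂ᴴ + D₁ * Y₀ᴴ))
    {P : Matrix (Fin d₁) (Fin r) ℂ × Matrix (Fin d₂) (Fin r) ℂ} (hP : P ≠ (X₀, Y₀)) :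
    objective a b (fun i => sketch (a i) (b i) (X₀ * Y₀ᴴ)) Xt Yt P <
      objective a b (fun i => sketch (a i) (b i) (X₀ * Y₀ᴴ)) Xt Yt (X₀, Y₀) := by
  obtain ⟨X, Y⟩ := P
  obtain ⟨D₁, rfl⟩ : ∃ D₁, X = X₀ + D₁ := ⟨X - X₀, by abel⟩
  obtain ⟨D₂, rfl⟩ : ∃ D₂, Y = Y₀ + D₂ := ⟨Y - Y₀, by abel⟩
  have hD : D₁ ≠ 0 ∨ D₂ ≠ 0 := by
    by_contra! h
    exact hP (by rw [h.1, h.2, add_zero, add_zero])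
  have hzero : meanAbsSketch a b (X₀ * Y₀ᴴ - X₀ * Y₀ᴴ) = 0 := by
    simp [meanAbsSketch, sketch]
  have hprod : (X₀ + D₁) * (Y₀ + D₂)ᴴ - X₀ * Y₀ᴴ = (X₀ * D₂ᴴ + D₁ * Y₀ᴴ) + D₁ * D₂ᴴ := by
    rw [Matrix.conjTranspose_add, Matrix.add_mul, Matrix.mul_add, Matrix.mul_add]; abel
  rw [objective_eq, objective_eq, hzero, hprod,
    smoothPart_add (isHermitian_sampleCov a) (isHermitian_sampleCov b)]
  have h1 := hgrad D₁ D₂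
  -- When the linearization vanishes, the gap between `c` and `ρ` gives nothing; strictness comes
  -- from positive definiteness of the quadratic forms.
  by_cases hH : X₀ * D₂ᴴ + D₁ * Y₀ᴴ = 0
  · rw [hH, frobNorm_eq_zero.2 rfl] at h1
    have h2 := meanAbsSketch_nonneg a b (X₀ * D₂ᴴ + D₁ * Y₀ᴴ + D₁ * D₂ᴴ)
    have h3 := half_frobNorm_sq_le ha D₁
    have h4 := half_frobNorm_sq_le hb D₂
    have h5 : 0 < frobNorm D₁ ^ 2 + frobNorm D₂ ^ 2 := by
      rcases hD with h | h
      · have := lt_of_le_of_ne (frobNorm_nonneg D₁) fun h' => h (frobNorm_eq_zero.1 h'.symm)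
        positivity
      · have := lt_of_le_of_ne (frobNorm_nonneg D₂) fun h' => h (frobNorm_eq_zero.1 h'.symm)
        positivity
    linarith
  -- Here the quadratic forms cancel, and strictness comes from `c < ρ`.
  · have h2 := meanAbsSketch_add_mul_ge a b (X₀ * D₂ᴴ + D₁ * Y₀ᴴ) D₁ D₂
    have h3 := hsk D₁ D₂
    have h4 := lt_of_le_of_ne (frobNorm_nonneg _) fun h' => hH (frobNorm_eq_zero.1 h'.symm)
    have h5 := mul_lt_mul_of_pos_right hc h4
    linarith

end

section

variable {d d₁ d₂ r n : ℕ}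

/-! ### Factorizations maximizing the smooth part -/

theorem isCompact_frobNorm_sub_le (X₁ : Matrix (Fin d) (Fin r) ℂ) (R : ℝ) :
    IsCompact {X : Matrix (Fin d) (Fin r) ℂ | frobNorm (X - X₁) ≤ R} := by
  let _ := Matrix.frobeniusNormedAddCommGroup (m := Fin d) (n := Fin r) (α := ℂ)
  let _ := Matrix.frobeniusNormedSpace (m := Fin d) (n := Fin r) (R := ℂ) (α := ℂ)
  have : ProperSpace (Matrix (Fin d) (Fin r) ℂ) := FiniteDimensional.proper ℂ _
  have h := isCompact_closedBall X₁ R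
  have h2 : Metric.closedBall X₁ R = {X : Matrix (Fin d) (Fin r) ℂ | frobNorm (X - X₁) ≤ R} := by
    ext X
    rw [mem_closedBall_iff_norm]
    rfl
  rw [h2] at h
  exact h

theorem continuous_smoothPart (A : Matrix (Fin d₁) (Fin d₁) ℂ) (B : Matrix (Fin d₂) (Fin d₂) ℂ)
    (Xt : Matrix (Fin d₁) (Fin r) ℂ) (Yt : Matrix (Fin d₂) (Fin r) ℂ) :
    Continuous fun P : Matrix (Fin d₁) (Fin r) ℂ × Matrix (Fin d₂) (Fin r) ℂ =>
      smoothPart A B Xt Yt P.1 P.2 := by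
  unfold smoothPart realInner
  fun_prop

/-- Strong concavity: a displacement that does not decrease the smooth part is bounded by the
gradient at the base point. This gives coercivity and later the distance to the maximizer. -/
theorem frobNorm_le_of_smoothPart_le {A : Matrix (Fin d₁) (Fin d₁) ℂ}
    {B : Matrix (Fin d₂) (Fin d₂) ℂ} (hA : Aᴴ = A) (hB : Bᴴ = B) (hA' : specNorm (1 - A) ≤ 1 / 2)
    (hB' : specNorm (1 - B) ≤ 1 / 2) {Xt X₁ D₁ : Matrix (Fin d₁) (Fin r) ℂ}
    {Yt Y₁ D₂ : Matrix (Fin d₂) (Fin r) ℂ}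
    (h : smoothPart A B Xt Yt X₁ Y₁ ≤ smoothPart A B Xt Yt (X₁ + D₁) (Y₁ + D₂)) :
    frobNorm D₁ ≤ 4 * (frobNorm (Xt - A * X₁) + frobNorm (Yt - B * Y₁)) ∧
      frobNorm D₂ ≤ 4 * (frobNorm (Xt - A * X₁) + frobNorm (Yt - B * Y₁)) := by
  rw [smoothPart_add hA hB] at h
  have h1 := realInner_le (Xt - A * X₁) D₁
  have h2 := realInner_le (Yt - B * Y₁) D₂
  have h3 := half_frobNorm_sq_le hA' D₁
  have h4 := half_frobNorm_sq_le hB' D₂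
  have hx := frobNorm_nonneg D₁
  have hy := frobNorm_nonneg D₂
  have he := frobNorm_nonneg (Xt - A * X₁)
  have hf := frobNorm_nonneg (Yt - B * Y₁)
  generalize frobNorm D₁ = x at *
  generalize frobNorm D₂ = y at *
  generalize frobNorm (Xt - A * X₁) = e at *
  generalize frobNorm (Yt - B * Y₁) = f at *
  have key : 1 / 4 * x ^ 2 + 1 / 4 * y ^ 2 ≤ e * x + f * y := by linarith
  rcases le_total x y with hxy | hxy
  · have : y ≤ 4 * (e + f) := by
      by_contra! hlt
      nlinarith [mul_le_mul_of_nonneg_left hxy he, sq_nonneg x]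
    exact ⟨hxy.trans this, this⟩
  · have : x ≤ 4 * (e + f) := by
      by_contra! hlt
      nlinarith [mul_le_mul_of_nonneg_left hxy hf, sq_nonneg y]
    exact ⟨this, hxy.trans this⟩

/-- The fibre is closed but possibly unbounded. Its points outside the two balls around `X₁` and
`Y₁` do worse than `(X₁, Y₁)`, so a maximizer over the compact part is global on the fibre. -/
theorem exists_isMaxOn_smoothPart {A : Matrix (Fin d₁) (Fin d₁) ℂ}
    {B : Matrix (Fin d₂) (Fin d₂) ℂ} (hA : Aᴴ = A) (hB : Bᴴ = B) (hA' : specNorm (1 - A) ≤ 1 / 2)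
    (hB' : specNorm (1 - B) ≤ 1 / 2) (Xt X₁ : Matrix (Fin d₁) (Fin r) ℂ)
    (Yt Y₁ : Matrix (Fin d₂) (Fin r) ℂ) :
    ∃ (X₀ : Matrix (Fin d₁) (Fin r) ℂ) (Y₀ : Matrix (Fin d₂) (Fin r) ℂ),
      X₀ * Y₀ᴴ = X₁ * Y₁ᴴ ∧
      (∀ (X : Matrix (Fin d₁) (Fin r) ℂ) (Y : Matrix (Fin d₂) (Fin r) ℂ),
        X * Yᴴ = X₁ * Y₁ᴴ → smoothPart A B Xt Yt X Y ≤ smoothPart A B Xt Yt X₀ Y₀) ∧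
      frobNorm (X₀ - X₁) ≤ 4 * (frobNorm (Xt - A * X₁) + frobNorm (Yt - B * Y₁)) ∧
      frobNorm (Y₀ - Y₁) ≤ 4 * (frobNorm (Xt - A * X₁) + frobNorm (Yt - B * Y₁)) := by
  obtain ⟨R, hR⟩ : ∃ R, R = 4 * (frobNorm (Xt - A * X₁) + frobNorm (Yt - B * Y₁)) := ⟨_, rfl⟩
  have hR0 : 0 ≤ R :=
    hR ▸ mul_nonneg (by norm_num) (add_nonneg (frobNorm_nonneg _) (frobNorm_nonneg _))
  have hcl : IsClosed {P : Matrix (Fin d₁) (Fin r) ℂ × Matrix (Fin d₂) (Fin r) ℂ |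
      P.1 * P.2ᴴ = X₁ * Y₁ᴴ} := isClosed_eq (by fun_prop) continuous_const
  have hcomp := ((isCompact_frobNorm_sub_le X₁ R).prod
    (isCompact_frobNorm_sub_le Y₁ R)).inter_right hcl
  have h0 : ∀ {p : ℕ} (X : Matrix (Fin p) (Fin r) ℂ), frobNorm (X - X) ≤ R := fun X => by
    rw [sub_self, frobNorm_eq_zero.2 rfl]; exact hR0
  obtain ⟨⟨X₀, Y₀⟩, hP, hmax⟩ := hcomp.exists_isMaxOn ⟨(X₁, Y₁), ⟨h0 X₁, h0 Y₁⟩, rfl⟩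
    (continuous_smoothPart A B Xt Yt).continuousOn
  rw [isMaxOn_iff] at hmax
  rw [← hR]
  refine ⟨X₀, Y₀, hP.2, fun X Y hXY => ?_, hP.1.1, hP.1.2⟩
  have h1 := hmax (X₁, Y₁) ⟨⟨h0 X₁, h0 Y₁⟩, rfl⟩
  rcases le_total (smoothPart A B Xt Yt X Y) (smoothPart A B Xt Yt X₁ Y₁) with h | h
  · exact h.trans h1
  · have h2 := frobNorm_le_of_smoothPart_le hA hB hA' hB' (X₁ := X₁) (D₁ := X - X₁) (Y₁ := Y₁)
      (D₂ := Y - Y₁) (Xt := Xt) (Yt := Yt)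
      (by rwa [add_sub_cancel, add_sub_cancel])
    rw [← hR] at h2
    exact hmax (X, Y) ⟨h2, hXY⟩

theorem hasDerivAt_exp_smul_entry (K : Matrix (Fin r) (Fin r) ℂ) (i j : Fin r) :
    HasDerivAt (fun t : ℝ => NormedSpace.exp (t • K) i j) (K i j) 0 := by
  let _ := Matrix.linftyOpNormedRing (n := Fin r) (α := ℂ)
  let _ := Matrix.linftyOpNormedAlgebra (n := Fin r) (R := ℝ) (α := ℂ)
  have h := hasDerivAt_exp_smul_const (𝕂 := ℝ) K 0
  rw [zero_smul, NormedSpace.exp_zero, one_mul] at h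
  exact ((Matrix.entryLinearMap ℝ ℂ i j).toContinuousLinearMap.hasFDerivAt).comp_hasDerivAt _ h

theorem exp_smul_mul_exp_neg_smul (K : Matrix (Fin r) (Fin r) ℂ) (t : ℝ) :
    NormedSpace.exp (t • K) * NormedSpace.exp (t • -K) = 1 := by
  rw [← Matrix.exp_add_of_commute, smul_neg, add_neg_cancel, NormedSpace.exp_zero]
  rw [smul_neg]
  exact (Commute.refl _).neg_right

theorem hasDerivAt_realInner {F G : ℝ → Matrix (Fin d) (Fin r) ℂ}
    {F' G' : Matrix (Fin d) (Fin r) ℂ} {t : ℝ}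
    (hF : ∀ i j, HasDerivAt (fun s => F s i j) (F' i j) t)
    (hG : ∀ i j, HasDerivAt (fun s => G s i j) (G' i j) t) :
    HasDerivAt (fun s => realInner (F s) (G s))
      (realInner F' (G t) + realInner (F t) G') t := by
  simp only [realInner_eq_sum, ← Finset.sum_add_distrib]
  refine HasDerivAt.fun_sum fun i _ => HasDerivAt.fun_sum fun j _ => ?_
  have h := (hF i j).star.mul (hG i j)
  exact Complex.reCLM.hasFDerivAt.comp_hasDerivAt t h

theorem hasDerivAt_const_mul_entry {F : ℝ → Matrix (Fin d) (Fin r) ℂ}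
    {F' : Matrix (Fin d) (Fin r) ℂ}
    {t : ℝ} (hF : ∀ i j, HasDerivAt (fun s => F s i j) (F' i j) t)
    (A : Matrix (Fin d₁) (Fin d) ℂ) (i : Fin d₁) (j : Fin r) :
    HasDerivAt (fun s => (A * F s) i j) ((A * F') i j) t := by
  simp only [Matrix.mul_apply]
  exact HasDerivAt.fun_sum fun k _ => (hF k j).const_mul (A i k)

/-- The curve `(X₀ exp(tK), Y₀ exp(-tK)*)` stays in the fibre, so the derivative of the smooth part
along it vanishes at `t = 0`. -/
theorem gradient_eq_of_isMaxOn_smoothPart {A : Matrix (Fin d₁) (Fin d₁) ℂ}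
    {B : Matrix (Fin d₂) (Fin d₂) ℂ} (hA : Aᴴ = A) (hB : Bᴴ = B)
    {Xt X₀ : Matrix (Fin d₁) (Fin r) ℂ} {Yt Y₀ : Matrix (Fin d₂) (Fin r) ℂ}
    (hmax : ∀ (X : Matrix (Fin d₁) (Fin r) ℂ) (Y : Matrix (Fin d₂) (Fin r) ℂ),
      X * Yᴴ = X₀ * Y₀ᴴ → smoothPart A B Xt Yt X Y ≤ smoothPart A B Xt Yt X₀ Y₀)
    (K : Matrix (Fin r) (Fin r) ℂ) :
    realInner (Xt - A * X₀) (X₀ * K) = realInner (Yt - B * Y₀) (Y₀ * Kᴴ) := by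
  -- `F` and `G` are the displacements along the curve. Both vanish at `0`, so the quadratic terms
  -- contribute no derivative there.
  set F : ℝ → Matrix (Fin d₁) (Fin r) ℂ := fun t => X₀ * (NormedSpace.exp (t • K) - 1) with hF
  set G : ℝ → Matrix (Fin d₂) (Fin r) ℂ :=
    fun t => Y₀ * (NormedSpace.exp (t • -K) - 1)ᴴ with hG
  have hF0 : F 0 = 0 := by simp [hF, NormedSpace.exp_zero]
  have hG0 : G 0 = 0 := by simp [hG, NormedSpace.exp_zero]
  have hFd : ∀ i j, HasDerivAt (fun s => F s i j) ((X₀ * K) i j) 0 :=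
    hasDerivAt_const_mul_entry (fun i j => by
      simpa using (hasDerivAt_exp_smul_entry K i j).sub_const ((1 : Matrix _ _ ℂ) i j)) X₀
  have hGd : ∀ i j, HasDerivAt (fun s => G s i j) ((Y₀ * (-K)ᴴ) i j) 0 :=
    hasDerivAt_const_mul_entry (fun i j => by
      simpa using
        ((hasDerivAt_exp_smul_entry (-K) j i).sub_const ((1 : Matrix _ _ ℂ) j i)).star) Y₀
  have hc : ∀ {p : ℕ} (E : Matrix (Fin p) (Fin r) ℂ) (i : Fin p) (j : Fin r),
      HasDerivAt (fun _ : ℝ => E i j) ((0 : Matrix (Fin p) (Fin r) ℂ) i j) 0 :=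
    fun E i j => hasDerivAt_const _ _
  have hd := (((hasDerivAt_realInner (hc (Xt - A * X₀)) hFd).add
    (hasDerivAt_realInner (hc (Yt - B * Y₀)) hGd)).sub
    ((hasDerivAt_realInner hFd (hasDerivAt_const_mul_entry hFd A)).const_mul (1 / 2))).sub
    ((hasDerivAt_realInner hGd (hasDerivAt_const_mul_entry hGd B)).const_mul (1 / 2))
  have hloc : IsLocalMax (fun t => realInner (Xt - A * X₀) (F t) + realInner (Yt - B * Y₀) (G t)
      - 1 / 2 * realInner (F t) (A * F t) - 1 / 2 * realInner (G t) (B * G t)) 0 := by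
    refine Filter.Eventually.of_forall fun t => ?_
    have hfib : (X₀ + F t) * (Y₀ + G t)ᴴ = X₀ * Y₀ᴴ := by
      have h1 : X₀ + F t = X₀ * NormedSpace.exp (t • K) := by simp [hF, Matrix.mul_sub]
      have h2 : Y₀ + G t = Y₀ * (NormedSpace.exp (t • -K))ᴴ := by
        simp [hG, Matrix.mul_sub]
      rw [h1, h2, Matrix.conjTranspose_mul, Matrix.conjTranspose_conjTranspose, Matrix.mul_assoc,
        ← Matrix.mul_assoc (NormedSpace.exp (t • K)), exp_smul_mul_exp_neg_smul, Matrix.one_mul]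
    have h3 := hmax _ _ hfib
    rw [smoothPart_add hA hB] at h3
    change realInner (Xt - A * X₀) (F t) + realInner (Yt - B * Y₀) (G t)
        - 1 / 2 * realInner (F t) (A * F t) - 1 / 2 * realInner (G t) (B * G t) ≤
      realInner (Xt - A * X₀) (F 0) + realInner (Yt - B * Y₀) (G 0)
        - 1 / 2 * realInner (F 0) (A * F 0) - 1 / 2 * realInner (G 0) (B * G 0)
    rw [hF0, hG0]
    simp only [realInner, Matrix.mul_zero, Matrix.trace_zero, Complex.zero_re] at h3 ⊢
    linarith
  have h0 := hloc.hasDerivAt_eq_zero hd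
  rw [hF0, hG0] at h0
  simp [realInner] at h0 ⊢
  linarith

/-! ### Bounding the gradient on the tangent space -/

theorem realInner_add_realInner_le {E₁ X₀ : Matrix (Fin d₁) (Fin r) ℂ}
    {E₂ Y₀ : Matrix (Fin d₂) (Fin r) ℂ} {s : ℝ} (hs : 0 < s)
    (hX : ∀ z, s * vecNorm z ≤ vecNorm (X₀ *ᵥ z)) (hY : ∀ z, s * vecNorm z ≤ vecNorm (Y₀ *ᵥ z))
    (hE : ∀ K : Matrix (Fin r) (Fin r) ℂ, realInner E₁ (X₀ * K) = realInner E₂ (Y₀ * Kᴴ))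
    (D₁ : Matrix (Fin d₁) (Fin r) ℂ) (D₂ : Matrix (Fin d₂) (Fin r) ℂ) :
    realInner E₁ D₁ + realInner E₂ D₂ ≤
      (frobNorm E₁ + frobNorm E₂) / s * frobNorm (X₀ * D₂ᴴ + D₁ * Y₀ᴴ) := by
  have hu : IsUnit (X₀ᴴ * X₀).det :=
    (Matrix.isUnit_iff_isUnit_det _).1 (isUnit_gram_of_bounded_below hs hX)
  -- Least-squares coefficients of `D₁` on the columns of `X₀`. Shifting by `(-X₀ K, Y₀ K*)` changes
  -- neither the linearization nor, by `hE`, the pairing, and makes the two summands of the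
  -- linearization orthogonal.
  set K := (X₀ᴴ * X₀)⁻¹ * (X₀ᴴ * D₁) with hK
  obtain ⟨F₁, hF₁⟩ : ∃ F₁, F₁ = D₁ - X₀ * K := ⟨_, rfl⟩
  obtain ⟨F₂, hF₂⟩ : ∃ F₂, F₂ = D₂ + Y₀ * Kᴴ := ⟨_, rfl⟩
  have horth : X₀ᴴ * F₁ = 0 := by
    rw [hF₁, Matrix.mul_sub, ← Matrix.mul_assoc, hK, ← Matrix.mul_assoc,
      Matrix.mul_nonsing_inv _ hu, Matrix.one_mul, sub_self]
  have hH : X₀ * D₂ᴴ + D₁ * Y₀ᴴ = X₀ * F₂ᴴ + F₁ * Y₀ᴴ := by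
    rw [hF₁, hF₂, Matrix.conjTranspose_add, Matrix.conjTranspose_mul,
      Matrix.conjTranspose_conjTranspose, Matrix.mul_add, Matrix.sub_mul, ← Matrix.mul_assoc]
    abel
  have hL : realInner E₁ D₁ + realInner E₂ D₂ = realInner E₁ F₁ + realInner E₂ F₂ := by
    rw [hF₁, hF₂, realInner_sub_right, realInner_add_right, hE]; ring
  rw [hH, hL]
  have hsq : frobNorm (X₀ * F₂ᴴ + F₁ * Y₀ᴴ) ^ 2 =
      frobNorm (X₀ * F₂ᴴ) ^ 2 + frobNorm (F₁ * Y₀ᴴ) ^ 2 := by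
    have h0 : realInner (X₀ * F₂ᴴ) (F₁ * Y₀ᴴ) = 0 := by
      rw [realInner_mul_left, ← Matrix.mul_assoc, horth]
      simp [realInner]
    rw [← realInner_self, realInner_add_left, realInner_add_right, realInner_add_right, h0,
      realInner_comm (F₁ * Y₀ᴴ), h0, realInner_self, realInner_self]
    ring
  set N := frobNorm (X₀ * F₂ᴴ + F₁ * Y₀ᴴ) with hN
  have hN0 : 0 ≤ N := frobNorm_nonneg _
  have h1 : s * frobNorm F₂ ≤ N := by
    rw [← frobNorm_conjTranspose]
    refine (mul_frobNorm_le_frobNorm_mul hs.le hX _).trans (le_of_sq_le_sq ?_ hN0)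
    nlinarith [sq_nonneg (frobNorm (F₁ * Y₀ᴴ))]
  have h2 : s * frobNorm F₁ ≤ N := by
    rw [← frobNorm_conjTranspose]
    refine (mul_frobNorm_le_frobNorm_mul hs.le hY _).trans (le_of_sq_le_sq ?_ hN0)
    rw [← frobNorm_conjTranspose, Matrix.conjTranspose_mul, Matrix.conjTranspose_conjTranspose]
    nlinarith [sq_nonneg (frobNorm (X₀ * F₂ᴴ))]
  rw [mul_comm, ← le_div_iff₀ hs] at h1 h2
  calc realInner E₁ F₁ + realInner E₂ F₂
      ≤ frobNorm E₁ * (N / s) + frobNorm E₂ * (N / s) :=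
        add_le_add
          ((realInner_le _ _).trans (mul_le_mul_of_nonneg_left h2 (frobNorm_nonneg _)))
          ((realInner_le _ _).trans (mul_le_mul_of_nonneg_left h1 (frobNorm_nonneg _)))
    _ = _ := by ring

end

section

variable {d₁ d₂ r n : ℕ}

/-! ### Singular values -/

theorem singularValue_antitone (M : Matrix (Fin d₁) (Fin d₂) ℂ) : Antitone (singularValue M) :=
  (Matrix.toEuclideanLin M).singularValues_antitone

theorem singularValue_pos {M : Matrix (Fin d₁) (Fin d₂) ℂ} {i : ℕ} (hi : i < M.rank) :
    0 < singularValue M i := by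
  refine (Matrix.toEuclideanLin M).singularValues_pos_iff_lt_finrank_range.2 ?_
  rwa [Matrix.rank_eq_finrank_range_toLin M (PiLp.basisFun 2 ℂ (Fin d₁))
    (PiLp.basisFun 2 ℂ (Fin d₂))] at hi

theorem vecNorm_diagonal_mulVec_sq (v : Fin r → ℝ) (x : Fin r → ℂ) :
    vecNorm (Matrix.diagonal (fun i => (v i : ℂ)) *ᵥ x) ^ 2 = ∑ i, v i ^ 2 * ‖x i‖ ^ 2 := by
  rw [vecNorm, EuclideanSpace.norm_sq_eq]
  simp [Matrix.mulVec_diagonal, mul_pow]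

theorem vecNorm_sq (x : Fin r → ℂ) : vecNorm x ^ 2 = ∑ i, ‖x i‖ ^ 2 := by
  rw [vecNorm, EuclideanSpace.norm_sq_eq]

theorem mul_vecNorm_le_vecNorm_diagonal_mulVec {v : Fin r → ℝ} {s : ℝ} (hs : 0 ≤ s)
    (hv : ∀ i, s ≤ v i) (x : Fin r → ℂ) :
    s * vecNorm x ≤ vecNorm (Matrix.diagonal (fun i => (v i : ℂ)) *ᵥ x) := by
  refine le_of_sq_le_sq ?_ (vecNorm_nonneg _)
  rw [mul_pow, vecNorm_diagonal_mulVec_sq, vecNorm_sq, Finset.mul_sum]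
  exact Finset.sum_le_sum fun i _ =>
    mul_le_mul_of_nonneg_right (pow_le_pow_left₀ hs (hv i) 2) (sq_nonneg _)

theorem specNorm_diagonal_le {v : Fin r → ℝ} {s : ℝ} (hs : 0 ≤ s) (hv0 : ∀ i, 0 ≤ v i)
    (hv : ∀ i, v i ≤ s) : specNorm (Matrix.diagonal (fun i => (v i : ℂ))) ≤ s := by
  refine specNorm_le hs fun x => le_of_sq_le_sq ?_ (mul_nonneg hs (vecNorm_nonneg _))
  rw [mul_pow, vecNorm_diagonal_mulVec_sq, vecNorm_sq, Finset.mul_sum]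
  exact Finset.sum_le_sum fun i _ =>
    mul_le_mul_of_nonneg_right (pow_le_pow_left₀ (hv0 i) (hv i) 2) (sq_nonneg _)

theorem specNorm_orthonormal_mul_le {d k : ℕ} {U : Matrix (Fin d) (Fin r) ℂ} (hU : Uᴴ * U = 1)
    (A : Matrix (Fin r) (Fin k) ℂ) : specNorm (U * A) ≤ specNorm A :=
  (specNorm_mul_le U A).trans
    (mul_le_of_le_one_left (specNorm_nonneg _) (specNorm_le_one_of_orthonormal hU))

theorem specNorm_conjTranspose_orthonormal_mul_le {d k : ℕ} {U : Matrix (Fin d) (Fin r) ℂ}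
    (hU : Uᴴ * U = 1) (A : Matrix (Fin d) (Fin k) ℂ) : specNorm (Uᴴ * A) ≤ specNorm A :=
  (specNorm_mul_le Uᴴ A).trans (mul_le_of_le_one_left (specNorm_nonneg _)
    ((specNorm_conjTranspose U).trans_le (specNorm_le_one_of_orthonormal hU)))

theorem vecNorm_conjTranspose_orthonormal_mulVec_le {d : ℕ} {U : Matrix (Fin d) (Fin r) ℂ}
    (hU : Uᴴ * U = 1) (x : Fin d → ℂ) : vecNorm (Uᴴ *ᵥ x) ≤ vecNorm x :=
  (vecNorm_mulVec_le _ _).trans (mul_le_of_le_one_left (vecNorm_nonneg _)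
    ((specNorm_conjTranspose U).trans_le (specNorm_le_one_of_orthonormal hU)))

theorem IsCompactSVD.specNorm_le {M : Matrix (Fin d₁) (Fin d₂) ℂ} {U : Matrix (Fin d₁) (Fin r) ℂ}
    {V : Matrix (Fin d₂) (Fin r) ℂ} (h : IsCompactSVD M U V) :
    specNorm M ≤ singularValue M 0 := by
  have h0 : ∀ i, 0 ≤ singularValue M i := (Matrix.toEuclideanLin M).singularValues_nonneg
  have h1 := specNorm_diagonal_le (v := fun i : Fin r => singularValue M i) (h0 0) (fun i => h0 i)
    fun i => singularValue_antitone M (Nat.zero_le _)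
  calc specNorm M ≤ specNorm (Matrix.diagonal (fun i : Fin r => (singularValue M i : ℂ)) * Vᴴ) := by
        conv_lhs => rw [h.eq_mul, Matrix.mul_assoc]
        exact specNorm_orthonormal_mul_le h.left_orthonormal _
    _ ≤ specNorm (Matrix.diagonal (fun i : Fin r => (singularValue M i : ℂ))) * specNorm Vᴴ :=
        specNorm_mul_le _ _
    _ ≤ singularValue M 0 * 1 := by
        refine mul_le_mul h1 ?_ (specNorm_nonneg _) (h0 0)
        rw [specNorm_conjTranspose]
        exact specNorm_le_one_of_orthonormal h.right_orthonormal
    _ = _ := mul_one _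

/-! ### Perturbation of balanced factors -/

/-- Balance gives `Y X*` and `X X*` the same Gram matrix, hence the same spectral norm. -/
theorem specNorm_sq_of_gram_eq {X : Matrix (Fin d₁) (Fin r) ℂ} {Y : Matrix (Fin d₂) (Fin r) ℂ}
    (h : Xᴴ * X = Yᴴ * Y) : specNorm X ^ 2 = specNorm (X * Yᴴ) := by
  have h1 : specNorm (X * Xᴴ) = specNorm X ^ 2 := by
    have := specNorm_conjTranspose_mul_self Xᴴ
    rwa [Matrix.conjTranspose_conjTranspose, specNorm_conjTranspose, ← sq] at this
  have h2 : (Y * Xᴴ)ᴴ * (Y * Xᴴ) = (X * Xᴴ)ᴴ * (X * Xᴴ) := by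
    simp only [Matrix.conjTranspose_mul, Matrix.conjTranspose_conjTranspose, Matrix.mul_assoc]
    rw [← Matrix.mul_assoc Yᴴ, ← h, Matrix.mul_assoc]
  have h3 := specNorm_conjTranspose_mul_self (Y * Xᴴ)
  rw [h2, specNorm_conjTranspose_mul_self, h1] at h3
  have h4 : specNorm (Y * Xᴴ) = specNorm (X * Yᴴ) := by
    rw [← specNorm_conjTranspose, Matrix.conjTranspose_mul, Matrix.conjTranspose_conjTranspose]
  rw [← h4]
  exact (mul_self_inj (sq_nonneg _) (specNorm_nonneg _)).1 h3

/-- With `z = Z* x`, one has `‖z‖² = ⟨Z z, x⟩ ≤ ‖Z z‖ ‖x‖` and `s‖x‖ ≤ ‖W z‖`. -/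
theorem mul_vecNorm_sq_le_of_mul_conjTranspose {W Z : Matrix (Fin r) (Fin r) ℂ} {s : ℝ}
    (hs : 0 < s) (h : ∀ x, s * vecNorm x ≤ vecNorm ((W * Zᴴ) *ᵥ x)) (z : Fin r → ℂ) :
    s * vecNorm z ^ 2 ≤ vecNorm (W *ᵥ z) * vecNorm (Z *ᵥ z) := by
  have hu := (Matrix.isUnit_iff_isUnit_det _).1 (isUnit_of_bounded_below hs h)
  rw [Matrix.det_mul] at hu
  have hZ : IsUnit Zᴴ := (Matrix.isUnit_iff_isUnit_det _).2 (isUnit_of_mul_isUnit_right hu)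
  obtain ⟨x, rfl⟩ := (Matrix.mulVec_surjective_iff_isUnit.2 hZ) z
  set z := Zᴴ *ᵥ x with hz
  have h1 := h x
  rw [← Matrix.mulVec_mulVec, ← hz] at h1
  have h2 : vecNorm z ^ 2 ≤ vecNorm (Z *ᵥ z) * vecNorm x := by
    have h3 : star (Z *ᵥ z) ⬝ᵥ x = (vecNorm z : ℂ) ^ 2 := by
      rw [star_mulVec_dotProduct, ← hz, dotProduct_star_self]
    have h4 := norm_star_dotProduct_le (Z *ᵥ z) x
    rw [h3, norm_pow, Complex.norm_real, Real.norm_of_nonneg (vecNorm_nonneg z)] at h4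
    exact h4
  calc s * vecNorm z ^ 2 ≤ s * (vecNorm (Z *ᵥ z) * vecNorm x) :=
        mul_le_mul_of_nonneg_left h2 hs.le
    _ = (s * vecNorm x) * vecNorm (Z *ᵥ z) := by ring
    _ ≤ _ := mul_le_mul_of_nonneg_right h1 (vecNorm_nonneg _)

theorem bounded_below_of_specNorm_sub_le {d : ℕ} {X Y : Matrix (Fin d) (Fin r) ℂ} {s ε : ℝ}
    (hX : ∀ z, s * vecNorm z ≤ vecNorm (X *ᵥ z)) (h : specNorm (X - Y) ≤ ε) (z : Fin r → ℂ) :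
    (s - ε) * vecNorm z ≤ vecNorm (Y *ᵥ z) := by
  have h1 := vecNorm_sub_le_vecNorm_sub (X *ᵥ z) (Y *ᵥ z)
  rw [← Matrix.sub_mulVec] at h1
  have h2 := vecNorm_mulVec_le (X - Y) z
  have h3 := mul_le_mul_of_nonneg_right h (vecNorm_nonneg z)
  have h4 := hX z
  linarith

/-- Compressing by `U*` and `V` makes the product square and close to `S`, which bounds `‖X z‖ ‖Y
z‖` below. Balance makes these two norms equal. -/
theorem bounded_below_of_gram_eq {X : Matrix (Fin d₁) (Fin r) ℂ} {Y : Matrix (Fin d₂) (Fin r) ℂ}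
    {U : Matrix (Fin d₁) (Fin r) ℂ} {V : Matrix (Fin d₂) (Fin r) ℂ} {S : Matrix (Fin r) (Fin r) ℂ}
    {s δ : ℝ} (hXY : Xᴴ * X = Yᴴ * Y) (hU : Uᴴ * U = 1) (hV : Vᴴ * V = 1)
    (hS : ∀ x, s * vecNorm x ≤ vecNorm (S *ᵥ x)) (hδ : specNorm (X * Yᴴ - U * S * Vᴴ) ≤ δ)
    (hsδ : δ < s) (z : Fin r → ℂ) : (s - δ) * vecNorm z ^ 2 ≤ vecNorm (X *ᵥ z) ^ 2 := by
  have hprod : S - (Uᴴ * X) * (Vᴴ * Y)ᴴ = -(Uᴴ * ((X * Yᴴ - U * S * Vᴴ) * V)) := by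
    have h1 : Uᴴ * (U * S * Vᴴ * V) = S := by
      simp only [Matrix.mul_assoc]
      rw [hV, Matrix.mul_one, ← Matrix.mul_assoc, hU, Matrix.one_mul]
    rw [Matrix.sub_mul, Matrix.mul_sub, h1, Matrix.conjTranspose_mul,
      Matrix.conjTranspose_conjTranspose]
    simp only [Matrix.mul_assoc]
    abel
  have hnorm : specNorm (S - (Uᴴ * X) * (Vᴴ * Y)ᴴ) ≤ δ := by
    rw [hprod, specNorm_neg]
    refine (specNorm_conjTranspose_orthonormal_mul_le hU _).trans
      ((specNorm_mul_le _ _).trans (le_trans ?_ hδ))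
    exact mul_le_of_le_one_right (specNorm_nonneg _) (specNorm_le_one_of_orthonormal hV)
  refine (mul_vecNorm_sq_le_of_mul_conjTranspose (sub_pos.2 hsδ)
    (bounded_below_of_specNorm_sub_le hS hnorm) z).trans ?_
  rw [← Matrix.mulVec_mulVec, ← Matrix.mulVec_mulVec, sq]
  refine mul_le_mul (vecNorm_conjTranspose_orthonormal_mulVec_le hU _) ?_ (vecNorm_nonneg _)
    (vecNorm_nonneg _)
  rw [vecNorm_mulVec_eq_of_gram_eq hXY]
  exact vecNorm_conjTranspose_orthonormal_mulVec_le hV _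

/-- Balanced factors whose product is close to a well-conditioned matrix are close to factors of
that matrix. -/
theorem exists_factorization_near {X : Matrix (Fin d₁) (Fin r) ℂ} {Y : Matrix (Fin d₂) (Fin r) ℂ}
    {U : Matrix (Fin d₁) (Fin r) ℂ} {V : Matrix (Fin d₂) (Fin r) ℂ} {S : Matrix (Fin r) (Fin r) ℂ}
    {t δ : ℝ} (hXY : Xᴴ * X = Yᴴ * Y) (hU : Uᴴ * U = 1) (hV : Vᴴ * V = 1) (ht : 0 < t)
    (hS : ∀ x, t ^ 2 * vecNorm x ≤ vecNorm (S *ᵥ x))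
    (hδ : specNorm (X * Yᴴ - U * S * Vᴴ) ≤ δ) (htδ : 1000 * δ ≤ t ^ 2) :
    ∃ (X₁ : Matrix (Fin d₁) (Fin r) ℂ) (Y₁ : Matrix (Fin d₂) (Fin r) ℂ),
      X₁ * Y₁ᴴ = U * S * Vᴴ ∧ (∀ z, t / 2 * vecNorm z ≤ vecNorm (X₁ *ᵥ z)) ∧
      (∀ z, t / 2 * vecNorm z ≤ vecNorm (Y₁ *ᵥ z)) ∧ specNorm (X - X₁) ≤ 3 * δ / t ∧
      specNorm (Y - Y₁) ≤ 3 * δ / t := by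
  obtain ⟨M, hM⟩ : ∃ M, M = U * S * Vᴴ := ⟨_, rfl⟩
  have hδ0 : 0 ≤ δ := (specNorm_nonneg _).trans hδ
  have ht2 : 0 < t ^ 2 := by positivity
  have hXlow : ∀ z, 3 / 4 * t * vecNorm z ≤ vecNorm (X *ᵥ z) := fun z => by
    have h1 := bounded_below_of_gram_eq hXY hU hV hS hδ (by linarith) z
    refine le_of_sq_le_sq (le_trans ?_ h1) (vecNorm_nonneg _)
    rw [mul_pow]
    exact mul_le_mul_of_nonneg_right (by nlinarith) (sq_nonneg _)
  have hYlow : ∀ z, 3 / 4 * t * vecNorm z ≤ vecNorm (Y *ᵥ z) := fun z => by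
    rw [← vecNorm_mulVec_eq_of_gram_eq hXY]; exact hXlow z
  have hsmall : 3 * δ / t ≤ t / 4 := by
    rw [div_le_iff₀ ht]; nlinarith
  rw [← hM] at hδ ⊢
  have hUM : U * (Uᴴ * M) = M := by
    rw [hM, Matrix.mul_assoc U S, ← Matrix.mul_assoc Uᴴ, hU, Matrix.one_mul]
  -- `X₁` is the projection of `X` onto the range of `U`. Since `U U*` fixes `M`, the error times
  -- `Y*` is `(1 - U U*)(X Y* - M)`, and `Y` is bounded below by `3t/4`.
  have hX1 : specNorm (X - U * (Uᴴ * X)) ≤ 3 * δ / t := by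
    have h1 : (Y * (X - U * (Uᴴ * X))ᴴ)ᴴ = (X * Yᴴ - M) + -(U * (Uᴴ * (X * Yᴴ - M))) := by
      rw [Matrix.conjTranspose_mul, Matrix.conjTranspose_conjTranspose, Matrix.sub_mul,
        Matrix.mul_sub, Matrix.mul_sub, hUM]
      simp only [Matrix.mul_assoc]
      abel
    have h2 : specNorm (Y * (X - U * (Uᴴ * X))ᴴ) ≤ 2 * δ := by
      rw [← specNorm_conjTranspose, h1]
      have h3 := (specNorm_orthonormal_mul_le hU (Uᴴ * (X * Yᴴ - M))).trans
        (specNorm_conjTranspose_orthonormal_mul_le hU _)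
      have h4 := specNorm_add_le (X * Yᴴ - M) (-(U * (Uᴴ * (X * Yᴴ - M))))
      rw [specNorm_neg] at h4
      linarith
    rw [← specNorm_conjTranspose]
    refine (specNorm_le_div_of_mul (by positivity) hYlow _).trans ?_
    rw [div_le_div_iff₀ (by positivity) ht]
    nlinarith [mul_le_mul_of_nonneg_right h2 ht.le, mul_nonneg hδ0 ht.le]
  have hX1low : ∀ z, t / 2 * vecNorm z ≤ vecNorm ((U * (Uᴴ * X)) *ᵥ z) := fun z =>
    (mul_le_mul_of_nonneg_right (by linarith) (vecNorm_nonneg z)).trans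
      (bounded_below_of_specNorm_sub_le hXlow hX1 z)
  have hWlow : ∀ z, t / 2 * vecNorm z ≤ vecNorm ((Uᴴ * X) *ᵥ z) := fun z => by
    rw [← vecNorm_mulVec_of_orthonormal hU ((Uᴴ * X) *ᵥ z), Matrix.mulVec_mulVec]
    exact hX1low z
  have hW := (Matrix.isUnit_iff_isUnit_det _).1 (isUnit_of_bounded_below (half_pos ht) hWlow)
  -- `Y₁` is forced by `X₁ Y₁* = M`, as `U* X` is invertible.
  have hY1 : specNorm (Y - ((Uᴴ * X)⁻¹ * (Uᴴ * M))ᴴ) ≤ 3 * δ / t := by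
    have h1 : (Uᴴ * X) * (Y - ((Uᴴ * X)⁻¹ * (Uᴴ * M))ᴴ)ᴴ = Uᴴ * (X * Yᴴ - M) := by
      rw [Matrix.conjTranspose_sub, Matrix.conjTranspose_conjTranspose, Matrix.mul_sub,
        ← Matrix.mul_assoc (Uᴴ * X) (Uᴴ * X)⁻¹, Matrix.mul_nonsing_inv _ hW, Matrix.one_mul,
        Matrix.mul_sub, Matrix.mul_assoc]
    have h2 : specNorm ((Uᴴ * X) * (Y - ((Uᴴ * X)⁻¹ * (Uᴴ * M))ᴴ)ᴴ) ≤ δ := by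
      rw [h1]
      exact (specNorm_conjTranspose_orthonormal_mul_le hU _).trans hδ
    rw [← specNorm_conjTranspose]
    refine (specNorm_le_div_of_mul (half_pos ht) hWlow _).trans ?_
    rw [div_le_div_iff₀ (half_pos ht) ht]
    nlinarith [mul_le_mul_of_nonneg_right h2 ht.le, mul_nonneg hδ0 ht.le]
  refine ⟨U * (Uᴴ * X), ((Uᴴ * X)⁻¹ * (Uᴴ * M))ᴴ, ?_, hX1low, fun z => ?_, hX1, hY1⟩
  · rw [Matrix.conjTranspose_conjTranspose, Matrix.mul_assoc U,
      ← Matrix.mul_assoc (Uᴴ * X) (Uᴴ * X)⁻¹, Matrix.mul_nonsing_inv _ hW, Matrix.one_mul, hUM]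
  · exact (mul_le_mul_of_nonneg_right (by linarith) (vecNorm_nonneg z)).trans
      (bounded_below_of_specNorm_sub_le hYlow hY1 z)

theorem exists_eq_mul_of_mul_conjTranspose_eq {k : ℕ} {X : Matrix (Fin d₁) (Fin r) ℂ}
    {Y : Matrix (Fin d₂) (Fin r) ℂ} {U : Matrix (Fin d₁) (Fin k) ℂ} {N : Matrix (Fin k) (Fin d₂) ℂ}
    {s : ℝ} (hs : 0 < s) (hY : ∀ z, s * vecNorm z ≤ vecNorm (Y *ᵥ z)) (h : X * Yᴴ = U * N) :
    ∃ G : Matrix (Fin k) (Fin r) ℂ, X = U * G := by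
  have hu := (Matrix.isUnit_iff_isUnit_det _).1 (isUnit_gram_of_bounded_below hs hY)
  refine ⟨N * (Y * (Yᴴ * Y)⁻¹), ?_⟩
  rw [← Matrix.mul_assoc, ← h, Matrix.mul_assoc, ← Matrix.mul_assoc Yᴴ,
    Matrix.mul_nonsing_inv _ hu, Matrix.mul_one]

/-- Since both factors are injective, they have the form `U G` and `V G'`. -/
theorem mem_supportSpace_of_factorization {X : Matrix (Fin d₁) (Fin r) ℂ}
    {Y : Matrix (Fin d₂) (Fin r) ℂ} {U : Matrix (Fin d₁) (Fin r) ℂ} {V : Matrix (Fin d₂) (Fin r) ℂ}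
    {S : Matrix (Fin r) (Fin r) ℂ} {s : ℝ} (hs : 0 < s)
    (hX : ∀ z, s * vecNorm z ≤ vecNorm (X *ᵥ z)) (hY : ∀ z, s * vecNorm z ≤ vecNorm (Y *ᵥ z))
    (h : X * Yᴴ = U * S * Vᴴ) (D₁ : Matrix (Fin d₁) (Fin r) ℂ) (D₂ : Matrix (Fin d₂) (Fin r) ℂ) :
    X * D₂ᴴ + D₁ * Yᴴ ∈ supportSpace U V := by
  obtain ⟨G, rfl⟩ := exists_eq_mul_of_mul_conjTranspose_eq hs hY
    (h.trans (Matrix.mul_assoc U S Vᴴ))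
  obtain ⟨G', rfl⟩ : ∃ G' : Matrix (Fin r) (Fin r) ℂ, Y = V * G' := by
    refine exists_eq_mul_of_mul_conjTranspose_eq (N := Sᴴ * Uᴴ) hs hX ?_
    have h' := congrArg Matrix.conjTranspose h
    simpa [Matrix.conjTranspose_mul, Matrix.mul_assoc] using h'
  refine ⟨D₁ * G'ᴴ, D₂ * Gᴴ, ?_⟩
  simp only [Matrix.conjTranspose_mul, Matrix.conjTranspose_conjTranspose, Matrix.mul_assoc]
  exact add_comm _ _

end

section

variable {d₁ d₂ r n : ℕ}

/-! ### Existence of the certificate -/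

/-- Split as `(X - X₁) + (1 - A) X₁`: the terms cost `3β` and `2β`. -/
theorem frobNorm_sub_mul_le {d : ℕ} {A : Matrix (Fin d) (Fin d) ℂ}
    {X X₁ : Matrix (Fin d) (Fin r) ℂ} {ε η L β : ℝ} (hA : specNorm (1 - A) ≤ ε)
    (hX : specNorm (X - X₁) ≤ η) (hL : specNorm X + η ≤ 2 * L)
    (hη : √(r : ℝ) * η ≤ 3 * β) (hε : √(r : ℝ) * ε * L ≤ β) :
    frobNorm (X - A * X₁) ≤ 5 * β := by
  have h1 : X - A * X₁ = (X - X₁) + (1 - A) * X₁ := by rw [Matrix.sub_mul, Matrix.one_mul]; abel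
  have h2 : specNorm X₁ ≤ 2 * L := by
    have h3 := specNorm_add_le X (-(X - X₁))
    rw [specNorm_neg, neg_sub, add_sub_cancel] at h3
    linarith
  have h4 := (frobNorm_le_sqrt_mul_specNorm (X - X₁)).trans
    (mul_le_mul_of_nonneg_left hX (Real.sqrt_nonneg _))
  have h5 : frobNorm X₁ ≤ √(r : ℝ) * (2 * L) :=
    (frobNorm_le_sqrt_mul_specNorm X₁).trans (mul_le_mul_of_nonneg_left h2 (Real.sqrt_nonneg _))
  have h6 : frobNorm ((1 - A) * X₁) ≤ ε * (√(r : ℝ) * (2 * L)) :=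
    (frobNorm_mul_le _ _).trans
      (mul_le_mul hA h5 (frobNorm_nonneg _) ((specNorm_nonneg _).trans hA))
  rw [h1]
  refine (frobNorm_add_le _ _).trans ?_
  linarith

theorem frobNorm_mul_le_of_specNorm_one_sub_le {d : ℕ} {A : Matrix (Fin d) (Fin d) ℂ}
    (hA : specNorm (1 - A) ≤ 1 / 2) (D : Matrix (Fin d) (Fin r) ℂ) :
    frobNorm (A * D) ≤ 3 / 2 * frobNorm D := by
  have h1 : A * D = D + -((1 - A) * D) := by rw [Matrix.sub_mul, Matrix.one_mul]; abel
  have h2 := (frobNorm_mul_le (1 - A) D).trans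
    (mul_le_mul_of_nonneg_right hA (frobNorm_nonneg D))
  have h3 := frobNorm_add_le D (-((1 - A) * D))
  rw [← h1, frobNorm_neg] at h3
  linarith

/-- In the application `t²` and `L²` are the least and greatest nonzero singular values, so `t` and
`L` are the scales of the factors. -/
theorem exists_certificate {A : Matrix (Fin d₁) (Fin d₁) ℂ} {B : Matrix (Fin d₂) (Fin d₂) ℂ}
    {X U : Matrix (Fin d₁) (Fin r) ℂ} {Y V : Matrix (Fin d₂) (Fin r) ℂ}
    {S : Matrix (Fin r) (Fin r) ℂ} {t L δ ε ρ : ℝ} (hA : Aᴴ = A) (hB : Bᴴ = B)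
    (hA' : specNorm (1 - A) ≤ ε) (hB' : specNorm (1 - B) ≤ ε) (hε : ε ≤ 1 / 2)
    (hXY : Xᴴ * X = Yᴴ * Y) (hU : Uᴴ * U = 1) (hV : Vᴴ * V = 1) (ht : 0 < t) (htL : t ≤ L)
    (hS : ∀ x, t ^ 2 * vecNorm x ≤ vecNorm (S *ᵥ x)) (hL : specNorm (U * S * Vᴴ) ≤ L ^ 2)
    (hδ : specNorm (X * Yᴴ - U * S * Vᴴ) ≤ δ) (hρ : 0 < ρ) (hρ1 : ρ ≤ 1) (hr : 0 < r)
    (hδr : 1000 * (√(r : ℝ) * δ) ≤ ρ * t ^ 2) (hεr : 1000 * (√(r : ℝ) * ε * L) ≤ ρ * t) :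
    ∃ (X₀ : Matrix (Fin d₁) (Fin r) ℂ) (Y₀ : Matrix (Fin d₂) (Fin r) ℂ),
      X₀ * Y₀ᴴ = U * S * Vᴴ ∧
      (∀ (D₁ : Matrix (Fin d₁) (Fin r) ℂ) (D₂ : Matrix (Fin d₂) (Fin r) ℂ),
        X₀ * D₂ᴴ + D₁ * Y₀ᴴ ∈ supportSpace U V) ∧
      ∀ (D₁ : Matrix (Fin d₁) (Fin r) ℂ) (D₂ : Matrix (Fin d₂) (Fin r) ℂ),
        realInner (X - A * X₀) D₁ + realInner (Y - B * Y₀) D₂ ≤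
          ρ / 2 * frobNorm (X₀ * D₂ᴴ + D₁ * Y₀ᴴ) := by
  have hδ0 : 0 ≤ δ := (specNorm_nonneg _).trans hδ
  have hsr : 1 ≤ √(r : ℝ) := Real.one_le_sqrt.2 (by exact_mod_cast hr)
  have htδ : 1000 * δ ≤ t ^ 2 := by
    nlinarith [mul_le_mul_of_nonneg_right hsr hδ0, sq_nonneg t]
  obtain ⟨X₁, Y₁, hM, hX₁, hY₁, hXX₁, hYY₁⟩ :=
    exists_factorization_near hXY hU hV ht hS hδ htδ
  have hη : 3 * δ / t ≤ L / 100 := by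
    rw [div_le_iff₀ ht]; nlinarith
  have hXL : specNorm X ≤ 3 / 2 * L := by
    have h1 := specNorm_sq_of_gram_eq hXY
    have h2 := specNorm_add_le (X * Yᴴ - U * S * Vᴴ) (U * S * Vᴴ)
    rw [sub_add_cancel] at h2
    exact le_of_sq_le_sq (by nlinarith) (by linarith)
  have hYL : specNorm Y ≤ 3 / 2 * L := by
    have h1 := specNorm_sq_of_gram_eq hXY
    have h3 := specNorm_sq_of_gram_eq hXY.symm
    have h4 : specNorm (Y * Xᴴ) = specNorm (X * Yᴴ) := by
      rw [← specNorm_conjTranspose, Matrix.conjTranspose_mul, Matrix.conjTranspose_conjTranspose]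
    refine le_of_sq_le_sq ?_ (by linarith)
    rw [h3, h4, ← h1]
    exact pow_le_pow_left₀ (specNorm_nonneg _) hXL 2
  -- The unit of error is `β = ρt/1000`; the gradient at `(X₁, Y₁)` is at most `5β` in each block.
  have hβ : √(r : ℝ) * (3 * δ / t) ≤ 3 * (ρ * t / 1000) := by
    rw [← mul_div_assoc, div_le_iff₀ ht]; nlinarith
  have hε' : √(r : ℝ) * ε * L ≤ ρ * t / 1000 := by linarith
  have he₁ := frobNorm_sub_mul_le hA' hXX₁ (by linarith) hβ hε'
  have he₂ := frobNorm_sub_mul_le hB' hYY₁ (by linarith) hβ hε'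
  have hA2 := hA'.trans hε
  have hB2 := hB'.trans hε
  obtain ⟨X₀, Y₀, hM₀, hmax, hX₀, hY₀⟩ := exists_isMaxOn_smoothPart hA hB hA2 hB2 X X₁ Y Y₁
  have hρt : ρ * t ≤ t := by nlinarith
  -- `4(5β + 5β) = 40β`.
  have hX₀' : frobNorm (X₀ - X₁) ≤ 1 / 25 * (ρ * t) := by linarith
  have hY₀' : frobNorm (Y₀ - Y₁) ≤ 1 / 25 * (ρ * t) := by linarith
  have hlow : ∀ {d : ℕ} {Z Z' : Matrix (Fin d) (Fin r) ℂ},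
      (∀ z, t / 2 * vecNorm z ≤ vecNorm (Z' *ᵥ z)) → frobNorm (Z - Z') ≤ 1 / 25 * (ρ * t) →
      ∀ z, 2 / 5 * t * vecNorm z ≤ vecNorm (Z *ᵥ z) := fun {d Z Z'} h1 h2 z => by
    have h3 : specNorm (Z' - Z) ≤ t / 25 := by
      rw [← specNorm_neg, neg_sub]
      exact (specNorm_le_frobNorm _).trans (by linarith)
    exact (mul_le_mul_of_nonneg_right (by linarith) (vecNorm_nonneg z)).trans
      (bounded_below_of_specNorm_sub_le h1 h3 z)
  have hlX := hlow hX₁ hX₀'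
  have hlY := hlow hY₁ hY₀'
  have hs : 0 < 2 / 5 * t := by positivity
  have hE : ∀ {d : ℕ} {C : Matrix (Fin d) (Fin d) ℂ} {Z Z₀ Z₁ : Matrix (Fin d) (Fin r) ℂ},
      specNorm (1 - C) ≤ 1 / 2 → frobNorm (Z - C * Z₁) ≤ 5 * (ρ * t / 1000) →
      frobNorm (Z₀ - Z₁) ≤ 1 / 25 * (ρ * t) → frobNorm (Z - C * Z₀) ≤ 2 / 25 * (ρ * t) :=
    fun {d C Z Z₀ Z₁} h1 h2 h3 => by
      have h4 : Z - C * Z₀ = (Z - C * Z₁) + -(C * (Z₀ - Z₁)) := by rw [Matrix.mul_sub]; abel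
      have h5 := frobNorm_mul_le_of_specNorm_one_sub_le h1 (Z₀ - Z₁)
      have h6 := frobNorm_add_le (Z - C * Z₁) (-(C * (Z₀ - Z₁)))
      rw [← h4, frobNorm_neg] at h6
      have h7 : 0 < ρ * t := mul_pos hρ ht
      linarith
  -- Moving to `X₀` raises the gradient bound to `5β + (3/2)·40β = 65β ≤ 80β`.
  have hE₁ := hE hA2 he₁ hX₀'
  have hE₂ := hE hB2 he₂ hY₀'
  refine ⟨X₀, Y₀, hM₀.trans hM, mem_supportSpace_of_factorization hs hlX hlY (hM₀.trans hM),
    fun D₁ D₂ => ?_⟩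
  refine (realInner_add_realInner_le hs hlX hlY (gradient_eq_of_isMaxOn_smoothPart hA hB
    fun X' Y' h => hmax X' Y' (h.trans hM₀)) D₁ D₂).trans
    (mul_le_mul_of_nonneg_right ?_ (frobNorm_nonneg _))
  -- The resulting constant is `(4/25)ρt / (2t/5) = 2ρ/5`, below `ρ/2`.
  rw [div_le_iff₀ hs]
  nlinarith [mul_pos hρ ht]

theorem existsUnique_isEstimate {a : Fin n → Fin d₁ → ℂ} {b : Fin n → Fin d₂ → ℂ}
    {Xt X₀ : Matrix (Fin d₁) (Fin r) ℂ} {Yt Y₀ : Matrix (Fin d₂) (Fin r) ℂ}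
    {m : Fin n → ℂ}
    (h : ∀ P, P ≠ (X₀, Y₀) → objective a b m Xt Yt P < objective a b m Xt Yt (X₀, Y₀)) :
    (∃! P, IsEstimate a b m Xt Yt P) ∧
      ∀ P, IsEstimate a b m Xt Yt P → P.1 * P.2ᴴ = X₀ * Y₀ᴴ := by
  have huniq : ∀ P, IsEstimate a b m Xt Yt P → P = (X₀, Y₀) := fun P hP => by
    by_contra hne
    exact (h P hne).not_ge (hP (Set.mem_univ (X₀, Y₀)))
  refine ⟨⟨(X₀, Y₀), fun P _ => ?_, huniq⟩, fun P hP => by rw [huniq P hP]⟩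
  by_cases hP : P = (X₀, Y₀)
  · rw [hP]; exact le_refl (objective a b m Xt Yt (X₀, Y₀))
  · exact (h P hP).le

end

end AnchoredRegression

end

open AnchoredRegression in
theorem mainTheorem5 :
    ∃ C₁ C₂ : ℝ, 1 ≤ C₁ ∧ 1 ≤ C₂ ∧
      ∀ (d₁ d₂ r n : ℕ) (a : Fin n → Fin d₁ → ℂ) (b : Fin n → Fin d₂ → ℂ)
        (M₀ : Matrix (Fin d₁) (Fin d₂) ℂ)
        (U₀ : Matrix (Fin d₁) (Fin r) ℂ) (V₀ : Matrix (Fin d₂) (Fin r) ℂ)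
        (Xt : Matrix (Fin d₁) (Fin r) ℂ) (Yt : Matrix (Fin d₂) (Fin r) ℂ) (ρ : ℝ),
        M₀ ≠ 0 →
        IsCompactSVD M₀ U₀ V₀ →
        Xtᴴ * Xt = Ytᴴ * Yt →
        0 < ρ → ρ ≤ 1 →
        (∀ H ∈ supportSpace U₀ V₀,
          ρ * frobNorm H ≤ 1 / (n : ℝ) * ∑ i, ‖sketch (a i) (b i) H‖) →
        specNorm (1 - sampleCov a) ≤ ρ / (C₁ * √((r : ℝ) * condNumber M₀)) →
        specNorm (1 - sampleCov b) ≤ ρ / (C₁ * √((r : ℝ) * condNumber M₀)) →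
        specNorm (Xt * Ytᴴ - M₀) ≤ ρ * specNorm M₀ / (C₂ * √(r : ℝ) * condNumber M₀ ^ 2) →
        (∃! P, IsEstimate a b (fun i => sketch (a i) (b i) M₀) Xt Yt P) ∧
          ∀ P, IsEstimate a b (fun i => sketch (a i) (b i) M₀) Xt Yt P → P.1 * P.2ᴴ = M₀ := by
  refine ⟨1000, 1000, by norm_num, by norm_num, ?_⟩
  intro d₁ d₂ r n a b M₀ U₀ V₀ Xt Yt ρ hM hsvd hbal hρ hρ1 hsk ha hb hanchor
  have hr : 0 < r := by
    rcases Nat.eq_zero_or_pos r with rfl | h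
    · exact absurd (by ext i j; rw [hsvd.eq_mul]; simp [Matrix.mul_apply]) hM
    · exact h
  obtain ⟨s, hs_def⟩ : ∃ s, s = singularValue M₀ (r - 1) := ⟨_, rfl⟩
  obtain ⟨σ, hσ_def⟩ : ∃ σ, σ = singularValue M₀ 0 := ⟨_, rfl⟩
  have hs : 0 < s := hs_def ▸ singularValue_pos (by rw [hsvd.rank_eq]; omega)
  have hsσ : s ≤ σ := by
    rw [hs_def, hσ_def]; exact singularValue_antitone M₀ (Nat.zero_le _)
  have hσ : 0 < σ := hs.trans_le hsσ
  have hκ : condNumber M₀ = σ / s := by rw [condNumber, hsvd.rank_eq, hs_def, hσ_def]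
  have hspec : specNorm M₀ ≤ σ := hσ_def ▸ hsvd.specNorm_le
  rw [hκ] at ha hb hanchor
  have hr' : (0 : ℝ) < r := by exact_mod_cast hr
  have hsr : 0 < √(r : ℝ) := Real.sqrt_pos.2 hr'
  have hts : √s ^ 2 = s := Real.sq_sqrt hs.le
  have hLσ : √σ ^ 2 = σ := Real.sq_sqrt hσ.le
  have ht : 0 < √s := Real.sqrt_pos.2 hs
  have hL : 0 < √σ := Real.sqrt_pos.2 hσ
  have hroot : √((r : ℝ) * (σ / s)) = √(r : ℝ) * (√σ / √s) := by
    rw [Real.sqrt_mul hr'.le, Real.sqrt_div hσ.le]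
  have hone : 1 ≤ √((r : ℝ) * (σ / s)) := by
    refine Real.one_le_sqrt.2 (one_le_mul_of_one_le_of_one_le (by exact_mod_cast hr) ?_)
    rwa [one_le_div hs]
  have hε : ρ / (1000 * √((r : ℝ) * (σ / s))) ≤ 1 / 2 := by
    rw [div_le_div_iff₀ (by positivity) two_pos]; linarith
  -- With `κ = σ/s ≥ 1`, `‖M₀‖ ≤ σ = sκ ≤ sκ²`.
  have hδ : specNorm (Xt * Ytᴴ - M₀) ≤ ρ * s / (1000 * √(r : ℝ)) := by
    refine hanchor.trans ?_
    rw [div_le_div_iff₀ (by positivity) (by positivity)]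
    have h2 : σ ≤ s * (σ / s) ^ 2 := by
      have : s * (σ / s) ^ 2 = σ * (σ / s) := by field_simp
      rw [this]
      exact le_mul_of_one_le_right hσ.le ((one_le_div hs).2 hsσ)
    calc ρ * specNorm M₀ * (1000 * √(r : ℝ)) ≤ ρ * (s * (σ / s) ^ 2) * (1000 * √(r : ℝ)) := by
          gcongr
          exact hspec.trans h2
      _ = _ := by ring
  have hlow : ∀ x, √s ^ 2 * vecNorm x ≤
      vecNorm (Matrix.diagonal (fun i : Fin r => (singularValue M₀ i : ℂ)) *ᵥ x) := by
    rw [hts]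
    refine mul_vecNorm_le_vecNorm_diagonal_mulVec (v := fun i : Fin r => singularValue M₀ i)
      hs.le fun i => ?_
    rw [hs_def]
    exact singularValue_antitone M₀ (by omega)
  obtain ⟨X₀, Y₀, hprod, hmem, hgrad⟩ := exists_certificate (t := √s) (L := √σ) (ρ := ρ)
    (δ := ρ * s / (1000 * √(r : ℝ)))
    (isHermitian_sampleCov a) (isHermitian_sampleCov b) ha hb hε hbal hsvd.left_orthonormal
    hsvd.right_orthonormal ht (Real.sqrt_le_sqrt hsσ) hlow
    (by rw [← hsvd.eq_mul, hLσ]; exact hspec) (by rw [← hsvd.eq_mul]; exact hδ) hρ hρ1 hr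
    -- Both smallness conditions hold with equality: `C₁ = C₂ = 1000` are the constants of
    -- `exists_certificate`, and `√κ = √σ/√s` cancels the factor `L/t`.
    (by rw [hts]; apply le_of_eq; field_simp)
    (by rw [hroot]; apply le_of_eq; field_simp)
  rw [← hsvd.eq_mul] at hprod
  subst hprod
  exact existsUnique_isEstimate fun P hP => objective_lt_of_certificate (ha.trans hε)
    (hb.trans hε) (half_lt_self hρ) (fun D₁ D₂ => hsk _ (hmem D₁ D₂)) hgrad hP
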